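/- Let $\ell>0$, $I=[0,\ell]$, $\alpha\in[0,\pi)$, $\beta\in(0,\pi]$, and for $q\in L^1(I,\mathbb R)$ let $\lambda_0(q)<\lambda_1(q)<\cdots$ be the eigenvalues of $$-z''+q(x)z=\lambda z\ \text{ on } I,\qquad z(0)\cos\alpha-z'(0)\sin\alpha=0,\qquad z(\ell)\cos\beta-z'(\ell)\sin\beta=0 .$$ (A solution of a linear equation $-z''+pz=f$ is a differentiable function $z$ on $I$ with $z'$ absolutely continuous that satisfies the equation almost everywhere.) Fix $n\ge 0$ and $q,h\in L^1(I,\mathbb R)$. Let $E_n$ be the eigenfunction for $\lambda_n(q)$ with $\int_0^\ell E_n^2\,dx=1$ and $E_n>0$ on some interval $(0,\delta)$. Let $$L:=\partial_s\lambda_n(q+sh)\big|_{s=0},$$ and let $U_n$ be the solution of $$-z''+(q(x)-\lambda_n(q))z=-E_n(x)(h(x)-L)\ \text{ on } I,\qquad z(0)=z'(0)=0 .$$ Then the derivative $L$ exists and equals $\int_0^\ell E_n^2h\,dx$, and the following hold. (i) $U_n$ also satisfies both boundary conditions $$U_n(0)\cos\alpha-U_n'(0)\sin\alpha=0,\qquad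 U_n(\ell)\cos\beta-U_n'(\ell)\sin\beta=0 .$$ (ii) If the boundary condition at $x=\ell$ is $z(\ell)=0$ (that is, $\beta=\pi$) or $z'(\ell)=0$ (that is, $\beta=\pi/2$), then $s\mapsto\lambda_n(q+sh)$ is twice differentiable at $s=0$ and $$\partial_{ss}\lambda_n(q+sh)\big|_{s=0}=-2\int_0^\ell\Big(U_n'(x)^2+(q(x)-\lambda_n(q))U_n(x)^2\Big)\,dx .$$ -/

import Mathlib

open Set Filter Topology MeasureTheory

namespace SturmLiouville

/-- The derivative `z'` of a function `z` on the interval `[0, ℓ]` (one-sided at the end-points).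
Functions on `[0, ℓ]` are represented by functions on `ℝ` whose values elsewhere are irrelevant. -/
noncomputable def dI (ℓ : ℝ) (z : ℝ → ℝ) : ℝ → ℝ := derivWithin z (Icc 0 ℓ)

/-- `z` is a (Caratheodory) solution on `[0, ℓ]` of the linear equation `-z'' + p z = f`:
`z` is differentiable, `z'` is absolutely continuous, and the equation holds almost everywhere. -/
structure IsSolution (ℓ : ℝ) (p f z : ℝ → ℝ) : Prop where
  differentiableOn : DifferentiableOn ℝ z (Icc 0 ℓ)
  absolutelyContinuous : AbsolutelyContinuousOnInterval (dI ℓ z) 0 ℓ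
  equation : ∀ᵐ x ∂(volume.restrict (Icc 0 ℓ)), -(dI ℓ (dI ℓ z)) x + p x * z x = f x

/-- The boundary condition `z(0) cos α - z'(0) sin α = 0`. -/
def LeftBC (ℓ α : ℝ) (z : ℝ → ℝ) : Prop :=
  z 0 * Real.cos α - dI ℓ z 0 * Real.sin α = 0

/-- The boundary condition `z(ℓ) cos β - z'(ℓ) sin β = 0`. -/
def RightBC (ℓ β : ℝ) (z : ℝ → ℝ) : Prop :=
  z ℓ * Real.cos β - dI ℓ z ℓ * Real.sin β = 0

/-- `z` solves the boundary value problem `-z'' + (q - lam) z = 0` with the two boundary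
conditions given by `α` and `β`, and is not identically zero on `[0, ℓ]`. -/
def IsEigenfunction (ℓ α β : ℝ) (q : ℝ → ℝ) (lam : ℝ) (z : ℝ → ℝ) : Prop :=
  IsSolution ℓ (fun x => q x - lam) (fun _ => 0) z ∧ LeftBC ℓ α z ∧ RightBC ℓ β z ∧
    ∃ x ∈ Icc 0 ℓ, z x ≠ 0

/-- `lam` is an eigenvalue of `-z'' + q z = lam z` under the boundary conditions `α`, `β`. -/
def IsEigenvalue (ℓ α β : ℝ) (q : ℝ → ℝ) (lam : ℝ) : Prop :=
  ∃ z : ℝ → ℝ, IsEigenfunction ℓ α β q lam z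

/-- `lam` is the `n`-th eigenvalue in increasing order, counted from `n = 0`: it is an eigenvalue
and exactly `n` eigenvalues are smaller (all eigenvalues of the problem are simple). -/
def IsNthEigenvalue (ℓ α β : ℝ) (q : ℝ → ℝ) (n : ℕ) (lam : ℝ) : Prop :=
  IsEigenvalue ℓ α β q lam ∧ {μ : ℝ | IsEigenvalue ℓ α β q μ ∧ μ < lam}.encard = n

/-- The `n`-th eigenvalue `lam_n(q)`, as a functional of the potential `q`; the set below has
at most one element, see `IsNthEigenvalue.nthEigenvalue_eq`. -/
noncomputable def nthEigenvalue (ℓ α β : ℝ) (n : ℕ) (q : ℝ → ℝ) : ℝ :=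
  sInf {lam : ℝ | IsNthEigenvalue ℓ α β q n lam}

theorem IsNthEigenvalue.not_lt {ℓ α β : ℝ} {q : ℝ → ℝ} {n : ℕ} {a b : ℝ}
    (ha : IsNthEigenvalue ℓ α β q n a) (hb : IsNthEigenvalue ℓ α β q n b) : ¬ a < b := by
  intro hab
  have hsub : insert a {μ : ℝ | IsEigenvalue ℓ α β q μ ∧ μ < a} ⊆
      {μ : ℝ | IsEigenvalue ℓ α β q μ ∧ μ < b} := by
    rintro x (rfl | ⟨h1, h2⟩)
    · exact ⟨ha.1, hab⟩
    · exact ⟨h1, h2.trans hab⟩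
  have h := Set.encard_le_encard hsub
  rw [Set.encard_insert_of_notMem (by simp), ha.2, hb.2] at h
  have h' : n + 1 ≤ n := by exact_mod_cast h
  omega

theorem IsNthEigenvalue.nthEigenvalue_eq {ℓ α β : ℝ} {q : ℝ → ℝ} {n : ℕ} {lam : ℝ}
    (h : IsNthEigenvalue ℓ α β q n lam) : nthEigenvalue ℓ α β n q = lam := by
  have hs : {μ : ℝ | IsNthEigenvalue ℓ α β q n μ} = {lam} := by
    ext μ
    refine ⟨fun hμ => ?_, fun hμ => ?_⟩
    · exact le_antisymm (le_of_not_gt (h.not_lt hμ)) (le_of_not_gt (hμ.not_lt h))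
    · rw [Set.mem_singleton_iff.mp hμ]
      exact h
  rw [nthEigenvalue, hs, csInf_singleton]

/-- `E` is the normalized eigenfunction `E_n(·; q)` of the `n`-th eigenvalue: its `L²` norm
on `[0, ℓ]` is `1`, and it is positive on some interval `(0, δ)`. -/
def IsNthNormalizedEigenfunction (ℓ α β : ℝ) (q : ℝ → ℝ) (n : ℕ) (E : ℝ → ℝ) : Prop :=
  (∃ lam : ℝ, IsNthEigenvalue ℓ α β q n lam ∧ IsEigenfunction ℓ α β q lam E) ∧
    (∫ x in (0 : ℝ)..ℓ, E x ^ 2) = 1 ∧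
    ∃ δ ∈ Ioc 0 ℓ, ∀ x ∈ Ioo 0 δ, 0 < E x

/-- The function `s ↦ lam_n(q + s h)`. -/
noncomputable def eigenvalueAlong (ℓ α β : ℝ) (n : ℕ) (q h : ℝ → ℝ) (s : ℝ) : ℝ :=
  nthEigenvalue ℓ α β n (fun x => q x + s * h x)

/-- `L`, the first derivative of `s ↦ lam_n(q + s h)` at `s = 0`. -/
noncomputable def firstDerivative (ℓ α β : ℝ) (n : ℕ) (q h : ℝ → ℝ) : ℝ :=
  deriv (eigenvalueAlong ℓ α β n q h) 0

/-- `g` is differentiable near `s` and its derivative is differentiable at `s` with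
derivative `d`, that is, `g` is twice differentiable at `s` with `g''(s) = d`. -/
def HasSecondDerivAt (g : ℝ → ℝ) (d s : ℝ) : Prop :=
  (∀ᶠ t in 𝓝 s, DifferentiableAt ℝ g t) ∧ HasDerivAt (deriv g) d s

/-- `U` is the function `U_n(·; q, h)`: the solution on `[0, ℓ]` of
`-z'' + (q - lam_n(q)) z = -E (h - L)` with `z(0) = z'(0) = 0`. -/
def IsUn (ℓ α β : ℝ) (n : ℕ) (q h E U : ℝ → ℝ) : Prop :=
  IsSolution ℓ (fun x => q x - nthEigenvalue ℓ α β n q)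
    (fun x => -(E x * (h x - firstDerivative ℓ α β n q h))) U ∧
  U 0 = 0 ∧ dI ℓ U 0 = 0

end SturmLiouville

/-!
Everything is read off from the solution `φ = shoot (lam, s)` of `φ'' = (q + s h - lam) φ` with
fixed initial data satisfying the boundary condition at `0`. Solutions are treated as pairs
`(z, z')` of absolutely continuous functions (`IsSystemSolution`); Gronwall's inequality with an
integrable kernel (`IsSystemSolution.norm_le`) gives uniqueness and continuous dependence on
`(lam, s)`, and a weighted contraction (`exists_isSystemSolution`) gives existence.

The eigenvalues of `q + s h` are the zeros in `lam` of `D = φ(ℓ) cos β - φ'(ℓ) sin β`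
(`isEigenvalue_iff`). Lagrange's identity (`IsSystemSolution.lagrange`) shows that `D` changes
sign at each zero and has at most one zero near it, for all nearby `s`, because `∫ φ_lam φ_mu > 0`
when `lam` and `mu` are close. The zeros are bounded below, uniformly for `|s| ≤ 1`
(`IsEigenvalue.lower_bound`). By compactness (`eventually_nth_zero`) the number of zeros below a
given one does not change for small `s`, so the `n`-th eigenvalue of `q + s h` exists and is
continuous in `s` at `0` (`IsNthEigenvalue.eventually_exists`).

Lagrange's identity for the parameters `(lam_n(0), 0)` and `(lam_n(s), s)` then identifies the
difference quotient of `lam_n` as `∫ h φ_0 φ_s / ∫ φ_0 φ_s`, which converges. Applied to the base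
potential `q + t h`, this yields `lam_n'(t) = ∫ h φ_t² / ∫ φ_t²` for all small `t`. The quotients
`(φ_s - φ_0) / s` solve the linearized problem up to an error tending to zero in `L¹`, so they
converge uniformly to `U` (`tendsto_difference_quotient`), and differentiating the quotient of
integrals gives `lam_n''(0) = 2 ∫ (h - L) E U`. The energy identity for `U` turns this into the
stated formula as soon as `U U'` vanishes at `ℓ`; that `U` satisfies the boundary condition there
is Lagrange's identity for `E` and `U`, since `∫ E² (h - L) = 0`.
-/

/-! ### Absolutely continuous functions -/

theorem AbsolutelyContinuousOnInterval.comp_lipschitzOnWith {f φ : ℝ → ℝ} {a b : ℝ} {s : Set ℝ}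
    {K : NNReal} (hf : AbsolutelyContinuousOnInterval f a b) (hφ : LipschitzOnWith K φ s)
    (hs : MapsTo f (uIcc a b) s) : AbsolutelyContinuousOnInterval (fun x => φ (f x)) a b := by
  rw [absolutelyContinuousOnInterval_iff] at hf ⊢
  intro ε hε
  obtain ⟨δ, hδ, H⟩ := hf (ε / (K + 1)) (by positivity)
  refine ⟨δ, hδ, fun E hE hlt => ?_⟩
  have hlt' := H E hE hlt
  calc ∑ i ∈ Finset.range E.1, dist (φ (f (E.2 i).1)) (φ (f (E.2 i).2))
      ≤ ∑ i ∈ Finset.range E.1, (K + 1) * dist (f (E.2 i).1) (f (E.2 i).2) := by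
        refine Finset.sum_le_sum fun i hi => ?_
        have h1 := hφ.dist_le_mul _ (hs (hE.1 i hi).1) _ (hs (hE.1 i hi).2)
        nlinarith [dist_nonneg (x := f (E.2 i).1) (y := f (E.2 i).2)]
    _ = (K + 1) * ∑ i ∈ Finset.range E.1, dist (f (E.2 i).1) (f (E.2 i).2) := by
        rw [Finset.mul_sum]
    _ < (K + 1) * (ε / (K + 1)) := by gcongr
    _ = ε := by field_simp

theorem AbsolutelyContinuousOnInterval.exp {f : ℝ → ℝ} {a b : ℝ}
    (hf : AbsolutelyContinuousOnInterval f a b) :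
    AbsolutelyContinuousOnInterval (fun x => Real.exp (f x)) a b := by
  obtain ⟨C, hC⟩ := hf.exists_bound
  obtain ⟨K, hK⟩ := (Real.contDiff_exp (n := 1)).contDiffOn.exists_lipschitzOnWith (by decide)
    (convex_Icc (-C) C) isCompact_Icc
  exact hf.comp_lipschitzOnWith hK fun x hx => abs_le.mp (hC x hx)

theorem AbsolutelyContinuousOnInterval.congr {f g : ℝ → ℝ} {a b : ℝ}
    (hf : AbsolutelyContinuousOnInterval f a b) (h : EqOn f g (uIcc a b)) :
    AbsolutelyContinuousOnInterval g a b := by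
  rw [absolutelyContinuousOnInterval_iff] at hf ⊢
  intro ε hε
  obtain ⟨δ, hδ, H⟩ := hf ε hε
  refine ⟨δ, hδ, fun E hE hlt => ?_⟩
  rw [Finset.sum_congr rfl fun i hi => by rw [← h (hE.1 i hi).1, ← h (hE.1 i hi).2]]
  exact H E hE hlt

namespace SturmLiouville

theorem intervalIntegrable_of_mem {ℓ x : ℝ} {f : ℝ → ℝ} (hf : IntervalIntegrable f volume 0 ℓ)
    (hx : x ∈ Icc 0 ℓ) : IntervalIntegrable f volume 0 x :=
  hf.mono_set (by rw [uIcc_of_le hx.1, uIcc_of_le (hx.1.trans hx.2)]; exact Icc_subset_Icc_right hx.2)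

theorem ac_of_mem {ℓ x : ℝ} {f : ℝ → ℝ} (hf : AbsolutelyContinuousOnInterval f 0 ℓ)
    (hx : x ∈ Icc 0 ℓ) : AbsolutelyContinuousOnInterval f 0 x :=
  hf.mono (by rw [uIcc_of_le hx.1, uIcc_of_le (hx.1.trans hx.2)]; exact Icc_subset_Icc_right hx.2)

theorem ac_continuousOn {ℓ : ℝ} (hℓ : 0 ≤ ℓ) {f : ℝ → ℝ}
    (hf : AbsolutelyContinuousOnInterval f 0 ℓ) : ContinuousOn f (Icc 0 ℓ) := by
  simpa [uIcc_of_le hℓ] using hf.continuousOn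

theorem mul_integrable {ℓ : ℝ} (hℓ : 0 ≤ ℓ) {f g : ℝ → ℝ}
    (hf : IntervalIntegrable f volume 0 ℓ) (hg : ContinuousOn g (Icc 0 ℓ)) :
    IntervalIntegrable (fun x => f x * g x) volume 0 ℓ :=
  hf.mul_continuousOn (by rwa [uIcc_of_le hℓ])

/-- The fundamental theorem of calculus for an absolutely continuous function with a prescribed
almost everywhere derivative. -/
theorem ftc_ac {ℓ : ℝ} (hℓ : 0 ≤ ℓ) {F F' : ℝ → ℝ} (hF : AbsolutelyContinuousOnInterval F 0 ℓ)
    (hd : ∀ᵐ x, x ∈ Icc 0 ℓ → HasDerivAt F (F' x) x) :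
    IntervalIntegrable F' volume 0 ℓ ∧ ∀ x ∈ Icc 0 ℓ, ∫ t in (0 : ℝ)..x, F' t = F x - F 0 := by
  constructor
  · refine hF.intervalIntegrable_deriv.congr_ae ?_
    rw [uIoc_of_le hℓ, EventuallyEq, ae_restrict_iff' measurableSet_Ioc]
    filter_upwards [hd] with x hx hx'
    exact (hx (Ioc_subset_Icc_self hx')).deriv
  · intro x hx
    rw [← (ac_of_mem hF hx).integral_deriv_eq_sub]
    refine intervalIntegral.integral_congr_ae ?_
    filter_upwards [hd] with t ht ht'
    rw [uIoc_of_le hx.1] at ht'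
    exact (ht ⟨ht'.1.le, ht'.2.trans hx.2⟩).deriv.symm

theorem primitive_ac {ℓ : ℝ} (hℓ : 0 ≤ ℓ) {f : ℝ → ℝ} (hf : IntervalIntegrable f volume 0 ℓ) :
    AbsolutelyContinuousOnInterval (fun x => ∫ t in (0 : ℝ)..x, f t) 0 ℓ ∧
    ∀ᵐ x, x ∈ Icc 0 ℓ → HasDerivAt (fun x => ∫ t in (0 : ℝ)..x, f t) (f x) x := by
  refine ⟨hf.absolutelyContinuousOnInterval_intervalIntegral (by simp), ?_⟩
  filter_upwards [hf.ae_hasDerivAt_integral] with x hx hx'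
  rw [uIcc_of_le hℓ] at hx
  exact hx hx' 0 (by simp [hℓ])

theorem ac_const {ℓ c : ℝ} : AbsolutelyContinuousOnInterval (fun _ => c) 0 ℓ :=
  (contDiffOn_const).absolutelyContinuousOnInterval

/-- Gronwall's inequality with an integrable kernel. -/
theorem gronwall_integrable {ℓ R : ℝ} (hℓ : 0 ≤ ℓ) {u g : ℝ → ℝ} (hu : ContinuousOn u (Icc 0 ℓ))
    (hg : IntervalIntegrable g volume 0 ℓ) (hg0 : ∀ x, 0 ≤ g x)
    (h : ∀ x ∈ Icc 0 ℓ, u x ≤ R + ∫ t in (0 : ℝ)..x, g t * u t) :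
    ∀ x ∈ Icc 0 ℓ, u x ≤ R * Real.exp (∫ t in (0 : ℝ)..x, g t) := by
  obtain ⟨hG, hG'⟩ := primitive_ac hℓ hg
  obtain ⟨hV, hV'⟩ := primitive_ac hℓ (mul_integrable hℓ hg hu)
  set G : ℝ → ℝ := fun x => ∫ t in (0 : ℝ)..x, g t with hGdef
  set V : ℝ → ℝ := fun x => ∫ t in (0 : ℝ)..x, g t * u t with hVdef
  -- The integrating factor makes `(R + ∫ g u) exp (-∫ g)` nonincreasing.
  have hW : AbsolutelyContinuousOnInterval (fun x => (R + V x) * Real.exp (-G x)) 0 ℓ :=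
    (ac_const.fun_add hV).fun_mul hG.fun_neg.exp
  have hW' : ∀ᵐ x, x ∈ Icc 0 ℓ → HasDerivAt (fun x => (R + V x) * Real.exp (-G x))
      (g x * u x * Real.exp (-G x) + (R + V x) * (Real.exp (-G x) * -g x)) x := by
    filter_upwards [hG', hV'] with x h1 h2 hx
    exact ((h2 hx).const_add R).mul (h1 hx).neg.exp
  obtain ⟨hi, hf⟩ := ftc_ac hℓ hW hW'
  intro x hx
  have h0 : (R + V x) * Real.exp (-G x) - R ≤ 0 := by
    have h1 := hf x hx
    have h2 : (R + V 0) * Real.exp (-G 0) = R := by simp [hVdef, hGdef]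
    rw [h2] at h1
    rw [← h1]
    refine (intervalIntegral.integral_mono_on (g := fun _ => (0 : ℝ)) hx.1
      (intervalIntegrable_of_mem hi hx) (by simp) ?_).trans_eq (by simp)
    intro t ht
    have h4 := h t ⟨ht.1, ht.2.trans hx.2⟩
    have h5 : g t * u t ≤ g t * (R + V t) := mul_le_mul_of_nonneg_left h4 (hg0 t)
    nlinarith [Real.exp_pos (-G t)]
  have h1 := h x hx
  have h2 : (R + V x) * Real.exp (-G x) ≤ R := by linarith
  rw [Real.exp_neg, ← div_eq_mul_inv, div_le_iff₀ (Real.exp_pos _)] at h2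
  exact h1.trans h2

/-! ### Solutions as pairs of absolutely continuous functions -/

/-- The first order form of `-z'' + p z = f` on `[0, ℓ]`: `z` and `w` are absolutely continuous,
`z' = w` and `w' = p z - f` almost everywhere. -/
structure IsSystemSolution (ℓ : ℝ) (p f z w : ℝ → ℝ) : Prop where
  ac_fst : AbsolutelyContinuousOnInterval z 0 ℓ
  ac_snd : AbsolutelyContinuousOnInterval w 0 ℓ
  deriv_fst : ∀ᵐ x, x ∈ Icc 0 ℓ → HasDerivAt z (w x) x
  deriv_snd : ∀ᵐ x, x ∈ Icc 0 ℓ → HasDerivAt w (p x * z x - f x) x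

theorem ae_mem_Ioo {ℓ : ℝ} : ∀ᵐ x : ℝ, x ∈ Icc 0 ℓ → x ∈ Ioo 0 ℓ := by
  have h0 : ∀ᵐ x : ℝ, x ≠ 0 := by simp [ae_iff, measure_singleton]
  have h1 : ∀ᵐ x : ℝ, x ≠ ℓ := by simp [ae_iff, measure_singleton]
  filter_upwards [h0, h1] with x h0 h1 hx
  exact ⟨lt_of_le_of_ne hx.1 h0.symm, lt_of_le_of_ne hx.2 h1⟩

theorem IsSolution.isSystemSolution {ℓ : ℝ} (hℓ : 0 < ℓ) {p f z : ℝ → ℝ}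
    (h : IsSolution ℓ p f z) : IsSystemSolution ℓ p f z (dI ℓ z) := by
  have hc : ContinuousOn (dI ℓ z) (Icc 0 ℓ) := ac_continuousOn hℓ.le h.absolutelyContinuous
  refine ⟨?_, h.absolutelyContinuous, ?_, ?_⟩
  · apply ContDiffOn.absolutelyContinuousOnInterval
    rw [uIcc_of_le hℓ.le, contDiffOn_one_iff_derivWithin (uniqueDiffOn_Icc hℓ)]
    exact ⟨h.differentiableOn, hc⟩
  · filter_upwards [ae_mem_Ioo (ℓ := ℓ)] with x hx hx'
    exact (h.differentiableOn x hx').hasDerivWithinAt.hasDerivAt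
      (Icc_mem_nhds (hx hx').1 (hx hx').2)
  · have he := h.equation
    rw [ae_restrict_iff' measurableSet_Icc] at he
    filter_upwards [ae_mem_Ioo (ℓ := ℓ), he, h.absolutelyContinuous.ae_differentiableAt]
      with x hx he hd hx'
    rw [uIcc_of_le hℓ.le] at hd
    have h1 : dI ℓ (dI ℓ z) x = deriv (dI ℓ z) x :=
      derivWithin_of_mem_nhds (Icc_mem_nhds (hx hx').1 (hx hx').2)
    have h2 : p x * z x - f x = deriv (dI ℓ z) x := by rw [← h1]; linarith [he hx']
    rw [h2]
    exact (hd hx').hasDerivAt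

namespace IsSystemSolution

variable {ℓ : ℝ} {p f z w : ℝ → ℝ}

theorem continuousOn_fst (hℓ : 0 ≤ ℓ) (h : IsSystemSolution ℓ p f z w) :
    ContinuousOn z (Icc 0 ℓ) := ac_continuousOn hℓ h.ac_fst

theorem continuousOn_snd (hℓ : 0 ≤ ℓ) (h : IsSystemSolution ℓ p f z w) :
    ContinuousOn w (Icc 0 ℓ) := ac_continuousOn hℓ h.ac_snd

theorem hasDerivWithinAt (hℓ : 0 < ℓ) (h : IsSystemSolution ℓ p f z w) {x : ℝ}
    (hx : x ∈ Icc 0 ℓ) : HasDerivWithinAt z (w x) (Icc 0 ℓ) x := by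
  have hw := h.continuousOn_snd hℓ.le
  have hz := (ftc_ac hℓ.le h.ac_fst h.deriv_fst).2
  -- The continuous extension of `w` turns the integral formula into the classical one.
  set w' : ℝ → ℝ := IccExtend hℓ.le ((Icc 0 ℓ).domRestrict w) with hw'
  have hw'c : Continuous w' := hw.domRestrict.Icc_extend'
  have he : ∀ t ∈ Icc 0 ℓ, w' t = w t := fun t ht => by
    rw [hw', IccExtend_of_mem _ _ ht]; rfl
  have h1 : HasDerivAt (fun y => z 0 + ∫ t in (0 : ℝ)..y, w' t) (w' x) x :=
    (intervalIntegral.integral_hasDerivAt_right (hw'c.intervalIntegrable _ _)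
      hw'c.aestronglyMeasurable.stronglyMeasurableAtFilter hw'c.continuousAt).const_add _
  rw [he x hx] at h1
  have h2 : ∀ y ∈ Icc 0 ℓ, z y = z 0 + ∫ t in (0 : ℝ)..y, w' t := by
    intro y hy
    have h3 : ∫ t in (0 : ℝ)..y, w' t = ∫ t in (0 : ℝ)..y, w t := by
      refine intervalIntegral.integral_congr fun t ht => ?_
      rw [uIcc_of_le hy.1] at ht
      exact he t ⟨ht.1, ht.2.trans hy.2⟩
    rw [h3, hz y hy]; ring
  exact h1.hasDerivWithinAt.congr h2 (h2 x hx)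

theorem dI_eq (hℓ : 0 < ℓ) (h : IsSystemSolution ℓ p f z w) {x : ℝ}
    (hx : x ∈ Icc 0 ℓ) : dI ℓ z x = w x :=
  (h.hasDerivWithinAt hℓ hx).derivWithin (uniqueDiffOn_Icc hℓ x hx)

theorem isSolution (hℓ : 0 < ℓ) (h : IsSystemSolution ℓ p f z w) : IsSolution ℓ p f z where
  differentiableOn _ hx := (h.hasDerivWithinAt hℓ hx).differentiableWithinAt
  absolutelyContinuous := h.ac_snd.congr fun x hx =>
    (h.dI_eq hℓ (by rwa [uIcc_of_le hℓ.le] at hx)).symm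
  equation := by
    rw [ae_restrict_iff' measurableSet_Icc]
    filter_upwards [ae_mem_Ioo (ℓ := ℓ), h.deriv_snd] with x hx hd hx'
    have h1 : dI ℓ (dI ℓ z) x = dI ℓ w x :=
      derivWithin_congr (fun y hy => h.dI_eq hℓ hy) (h.dI_eq hℓ hx')
    have h2 : dI ℓ w x = deriv w x :=
      derivWithin_of_mem_nhds (Icc_mem_nhds (hx hx').1 (hx hx').2)
    rw [h1, h2, (hd hx').deriv]
    ring

/-- The equation only matters along the solution: coefficient and right-hand side may be traded
against each other there. -/
theorem congr_equation {p' f' : ℝ → ℝ} (h : IsSystemSolution ℓ p f z w)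
    (he : ∀ x ∈ Icc 0 ℓ, p x * z x - f x = p' x * z x - f' x) :
    IsSystemSolution ℓ p' f' z w := by
  refine ⟨h.ac_fst, h.ac_snd, h.deriv_fst, ?_⟩
  filter_upwards [h.deriv_snd] with x hx hx'
  rw [← he x hx']
  exact hx hx'

theorem sub {f' z' w' : ℝ → ℝ} (h : IsSystemSolution ℓ p f z w)
    (h' : IsSystemSolution ℓ p f' z' w') :
    IsSystemSolution ℓ p (fun x => f x - f' x) (fun x => z x - z' x) (fun x => w x - w' x) := by
  refine ⟨h.ac_fst.fun_sub h'.ac_fst, h.ac_snd.fun_sub h'.ac_snd, ?_, ?_⟩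
  · filter_upwards [h.deriv_fst, h'.deriv_fst] with x h1 h2 hx
    exact (h1 hx).sub (h2 hx)
  · filter_upwards [h.deriv_snd, h'.deriv_snd] with x h1 h2 hx
    exact ((h1 hx).sub (h2 hx)).congr_deriv (by ring)

theorem const_mul (c : ℝ) (h : IsSystemSolution ℓ p f z w) :
    IsSystemSolution ℓ p (fun x => c * f x) (fun x => c * z x) (fun x => c * w x) := by
  refine ⟨h.ac_fst.const_mul c, h.ac_snd.const_mul c, ?_, ?_⟩
  · filter_upwards [h.deriv_fst] with x h1 hx
    exact (h1 hx).const_mul c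
  · filter_upwards [h.deriv_snd] with x h1 hx
    exact ((h1 hx).const_mul c).congr_deriv (by ring)

/-- The a priori estimate behind uniqueness and continuous dependence: Gronwall's inequality for
`|z| + |w|` with the kernel `1 + |p|`. -/
theorem norm_le (hℓ : 0 ≤ ℓ) (h : IsSystemSolution ℓ p f z w)
    (hp : IntervalIntegrable p volume 0 ℓ) (hf : IntervalIntegrable f volume 0 ℓ) :
    ∀ x ∈ Icc 0 ℓ, |z x| + |w x| ≤ (|z 0| + |w 0| + ∫ t in (0 : ℝ)..ℓ, |f t|) *
      Real.exp (ℓ + ∫ t in (0 : ℝ)..ℓ, |p t|) := by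
  have hzc := h.continuousOn_fst hℓ
  have hwc := h.continuousOn_snd hℓ
  obtain ⟨hwi, hz⟩ := ftc_ac hℓ h.ac_fst h.deriv_fst
  obtain ⟨hpi, hw⟩ := ftc_ac hℓ h.ac_snd h.deriv_snd
  have hg : IntervalIntegrable (fun x => 1 + |p x|) volume 0 ℓ :=
    intervalIntegrable_const.add hp.abs
  have hu : ContinuousOn (fun x => |z x| + |w x|) (Icc 0 ℓ) := hzc.abs.add hwc.abs
  have hgu := mul_integrable hℓ hg hu
  have key := gronwall_integrable (R := |z 0| + |w 0| + ∫ t in (0 : ℝ)..ℓ, |f t|) hℓ hu hg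
    (fun x => by positivity) (by
      intro x hx
      have h1 : |z x - z 0| ≤ ∫ t in (0 : ℝ)..x, |w t| := by
        rw [← hz x hx]; exact intervalIntegral.abs_integral_le_integral_abs hx.1
      have h2 : |w x - w 0| ≤ ∫ t in (0 : ℝ)..x, |p t * z t - f t| := by
        rw [← hw x hx]; exact intervalIntegral.abs_integral_le_integral_abs hx.1
      have h3 : ∫ t in (0 : ℝ)..x, |f t| ≤ ∫ t in (0 : ℝ)..ℓ, |f t| :=
        intervalIntegral.integral_mono_interval le_rfl hx.1 hx.2
          (Eventually.of_forall fun t => abs_nonneg _) hf.abs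
      have i1 := intervalIntegrable_of_mem hwi.abs hx
      have i2 := intervalIntegrable_of_mem hpi.abs hx
      have i3 := intervalIntegrable_of_mem hf.abs hx
      have i4 := intervalIntegrable_of_mem hgu hx
      have h4 : (∫ t in (0 : ℝ)..x, |w t|) + ∫ t in (0 : ℝ)..x, |p t * z t - f t| ≤
          (∫ t in (0 : ℝ)..x, |f t|) + ∫ t in (0 : ℝ)..x, (1 + |p t|) * (|z t| + |w t|) := by
        rw [← intervalIntegral.integral_add i1 i2, ← intervalIntegral.integral_add i3 i4]
        refine intervalIntegral.integral_mono_on hx.1 (i1.add i2) (i3.add i4) fun t _ => ?_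
        have h5 := abs_sub (p t * z t) (f t)
        rw [abs_mul] at h5
        nlinarith [abs_nonneg (p t), abs_nonneg (z t), abs_nonneg (w t),
          mul_nonneg (abs_nonneg (p t)) (abs_nonneg (w t))]
      have h6 := abs_sub_abs_le_abs_sub (z x) (z 0)
      have h7 := abs_sub_abs_le_abs_sub (w x) (w 0)
      linarith)
  intro x hx
  refine (key x hx).trans ?_
  have hf0 : 0 ≤ ∫ t in (0 : ℝ)..ℓ, |f t| :=
    intervalIntegral.integral_nonneg hℓ fun t _ => abs_nonneg _
  have h8 : ∫ t in (0 : ℝ)..x, (1 + |p t|) ≤ ℓ + ∫ t in (0 : ℝ)..ℓ, |p t| := by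
    calc ∫ t in (0 : ℝ)..x, (1 + |p t|) ≤ ∫ t in (0 : ℝ)..ℓ, (1 + |p t|) :=
          intervalIntegral.integral_mono_interval le_rfl hx.1 hx.2
            (Eventually.of_forall fun t => by positivity) hg
      _ = ℓ + ∫ t in (0 : ℝ)..ℓ, |p t| := by
          rw [intervalIntegral.integral_add intervalIntegrable_const hp.abs]; simp
  gcongr

/-- A solution with vanishing initial data and vanishing right-hand side is zero. -/
theorem eq_zero (hℓ : 0 ≤ ℓ) (h : IsSystemSolution ℓ p (fun _ => 0) z w)
    (hp : IntervalIntegrable p volume 0 ℓ) (h0 : z 0 = 0) (h1 : w 0 = 0) {x : ℝ}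
    (hx : x ∈ Icc 0 ℓ) : z x = 0 ∧ w x = 0 := by
  have := h.norm_le hℓ hp (by simp) x hx
  simp only [h0, h1, abs_zero, intervalIntegral.integral_zero, add_zero, zero_mul] at this
  constructor <;> apply abs_eq_zero.mp <;> linarith [abs_nonneg (z x), abs_nonneg (w x)]

/-- Lagrange's identity for two solutions. -/
theorem lagrange (hℓ : 0 ≤ ℓ) {p' f' z' w' : ℝ → ℝ} (h : IsSystemSolution ℓ p f z w)
    (h' : IsSystemSolution ℓ p' f' z' w') :
    ∫ x in (0 : ℝ)..ℓ, ((p' x - p x) * (z x * z' x) - z x * f' x + z' x * f x) =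
      (z ℓ * w' ℓ - w ℓ * z' ℓ) - (z 0 * w' 0 - w 0 * z' 0) := by
  have hac := (h.ac_fst.fun_mul h'.ac_snd).fun_sub (h.ac_snd.fun_mul h'.ac_fst)
  refine (ftc_ac hℓ hac ?_).2 ℓ ⟨hℓ, le_rfl⟩
  filter_upwards [h.deriv_fst, h.deriv_snd, h'.deriv_fst, h'.deriv_snd] with x h1 h2 h3 h4 hx
  exact (((h1 hx).mul (h4 hx)).sub ((h2 hx).mul (h3 hx))).congr_deriv (by ring)

/-- The energy identity, obtained by integrating `(z z')'`. -/
theorem energy (hℓ : 0 ≤ ℓ) (h : IsSystemSolution ℓ p f z w) :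
    ∫ x in (0 : ℝ)..ℓ, (w x ^ 2 + p x * z x ^ 2 - z x * f x) = z ℓ * w ℓ - z 0 * w 0 := by
  refine (ftc_ac hℓ (h.ac_fst.fun_mul h.ac_snd) ?_).2 ℓ ⟨hℓ, le_rfl⟩
  filter_upwards [h.deriv_fst, h.deriv_snd] with x h1 h2 hx
  exact ((h1 hx).mul (h2 hx)).congr_deriv (by ring)

end IsSystemSolution

/-! ### Existence for the initial value problem -/

/-- One Picard step for `z'' = p z`, `z 0 = a`, `z' 0 = b`: with `u` in place of `z` on the
right-hand side, two integrations give absolutely continuous functions. -/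
theorem volterra_ac {ℓ : ℝ} (hℓ : 0 ≤ ℓ) {p u : ℝ → ℝ} (a b : ℝ)
    (hp : IntervalIntegrable p volume 0 ℓ) (hu : ContinuousOn u (Icc 0 ℓ)) :
    let w : ℝ → ℝ := fun x => b + ∫ t in (0 : ℝ)..x, p t * u t
    let z : ℝ → ℝ := fun x => a + ∫ t in (0 : ℝ)..x, w t
    AbsolutelyContinuousOnInterval w 0 ℓ ∧ AbsolutelyContinuousOnInterval z 0 ℓ ∧
      (∀ᵐ x, x ∈ Icc 0 ℓ → HasDerivAt w (p x * u x) x) ∧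
      ∀ᵐ x, x ∈ Icc 0 ℓ → HasDerivAt z (w x) x := by
  intro w z
  obtain ⟨h1, h2⟩ := primitive_ac hℓ (mul_integrable hℓ hp hu)
  have hw : AbsolutelyContinuousOnInterval w 0 ℓ := ac_const.fun_add h1
  obtain ⟨h3, h4⟩ := primitive_ac hℓ (hw.continuousOn.intervalIntegrable)
  refine ⟨hw, ac_const.fun_add h3, ?_, ?_⟩
  · filter_upwards [h2] with x hx hx'
    exact (hx hx').const_add b
  · filter_upwards [h4] with x hx hx'
    exact (hx hx').const_add a

/-- The weight `exp (K ∫₀ˣ |p|)` turns integration against `|p|` into a gain of a factor `K⁻¹`. -/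
theorem integral_abs_mul_exp_le {ℓ K : ℝ} (hℓ : 0 ≤ ℓ) (hK : 0 < K) {p : ℝ → ℝ}
    (hp : IntervalIntegrable p volume 0 ℓ) {x : ℝ} (hx : x ∈ Icc 0 ℓ) :
    IntervalIntegrable (fun t => |p t| * Real.exp (K * ∫ s in (0 : ℝ)..t, |p s|)) volume 0 ℓ ∧
    ∫ t in (0 : ℝ)..x, |p t| * Real.exp (K * ∫ s in (0 : ℝ)..t, |p s|) ≤
      Real.exp (K * ∫ s in (0 : ℝ)..x, |p s|) / K := by
  obtain ⟨h1, h2⟩ := primitive_ac hℓ hp.abs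
  have h3 := (h1.const_mul K).exp.const_mul K⁻¹
  obtain ⟨h4, h5⟩ := ftc_ac hℓ h3
    (F' := fun t => |p t| * Real.exp (K * ∫ s in (0 : ℝ)..t, |p s|)) (by
      filter_upwards [h2] with t ht ht'
      refine (((ht ht').const_mul K).exp.const_mul K⁻¹).congr_deriv ?_
      field_simp)
  refine ⟨h4, ?_⟩
  rw [h5 x hx, div_eq_inv_mul]
  have : 0 < K⁻¹ * Real.exp (K * ∫ s in (0 : ℝ)..0, |p s|) := by positivity
  linarith

/-- Existence for the initial value problem. In the unknown `y = exp (-2 ℓ ∫₀ˣ |p|) z` the Picard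
operator is a contraction of `C([0, ℓ])` with constant `1 / 2`. -/
theorem exists_isSystemSolution {ℓ : ℝ} (hℓ : 0 < ℓ) {p : ℝ → ℝ}
    (hp : IntervalIntegrable p volume 0 ℓ) (a b : ℝ) :
    ∃ z w : ℝ → ℝ, IsSystemSolution ℓ p (fun _ => 0) z w ∧ z 0 = a ∧ w 0 = b := by
  set K : ℝ := 2 * ℓ with hK
  have hK0 : 0 < K := by positivity
  set e : ℝ → ℝ := fun x => Real.exp (K * ∫ s in (0 : ℝ)..x, |p s|) with he
  have hec : ContinuousOn e (Icc 0 ℓ) :=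
    ac_continuousOn hℓ.le ((primitive_ac hℓ.le hp.abs).1.const_mul K).exp
  have hemono : ∀ t x, 0 ≤ t → t ≤ x → x ≤ ℓ → e t ≤ e x := by
    intro t x h0 h1 h2
    refine Real.exp_le_exp.mpr (mul_le_mul_of_nonneg_left ?_ hK0.le)
    exact intervalIntegral.integral_mono_interval le_rfl h0 h1
      (Eventually.of_forall fun t => abs_nonneg _)
      (intervalIntegrable_of_mem hp.abs ⟨h0.trans h1, h2⟩)
  let X (y : C(Icc (0 : ℝ) ℓ, ℝ)) : ℝ → ℝ := fun x => e x * IccExtend hℓ.le y x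
  have hX (y) : ContinuousOn (X y) (Icc 0 ℓ) := hec.mul y.continuous.Icc_extend'.continuousOn
  let W (y : C(Icc (0 : ℝ) ℓ, ℝ)) : ℝ → ℝ := fun x => b + ∫ t in (0 : ℝ)..x, p t * X y t
  let Z (y : C(Icc (0 : ℝ) ℓ, ℝ)) : ℝ → ℝ := fun x => a + ∫ t in (0 : ℝ)..x, W y t
  have hWZ (y) := volterra_ac hℓ.le a b hp (hX y)
  let T (y : C(Icc (0 : ℝ) ℓ, ℝ)) : C(Icc (0 : ℝ) ℓ, ℝ) :=
    ⟨fun x => (e x)⁻¹ * Z y x, by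
      have h1 : ContinuousOn (fun x => (e x)⁻¹ * Z y x) (Icc 0 ℓ) :=
        (hec.inv₀ fun x _ => (Real.exp_pos _).ne').mul (ac_continuousOn hℓ.le (hWZ y).2.1)
      exact continuousOn_iff_continuous_domRestrict.mp h1⟩
  have hTapp (y) {x : ℝ} (hx : x ∈ Icc 0 ℓ) : T y ⟨x, hx⟩ = (e x)⁻¹ * Z y x := rfl
  have hWint (y) : IntervalIntegrable (W y) volume 0 ℓ := (hWZ y).1.continuousOn.intervalIntegrable
  have hT : ContractingWith (1 / 2) T := by
    refine ⟨by norm_num, LipschitzWith.of_dist_le_mul fun y y' => ?_⟩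
    rw [ContinuousMap.dist_le (by positivity)]
    intro ⟨x, hx⟩
    set d := dist y y' with hd
    have hd0 : 0 ≤ d := dist_nonneg
    have hXd : ∀ t ∈ Icc 0 ℓ, |X y t - X y' t| ≤ e t * d := by
      intro t ht
      have h1 : |y ⟨t, ht⟩ - y' ⟨t, ht⟩| ≤ d := by
        rw [← Real.dist_eq]; exact ContinuousMap.dist_apply_le_dist _
      simp only [X, IccExtend_of_mem _ _ ht, ← mul_sub, abs_mul]
      rw [abs_of_pos (Real.exp_pos _)]
      exact mul_le_mul_of_nonneg_left h1 (Real.exp_pos _).le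
    have hWd : ∀ t ∈ Icc 0 ℓ, |W y t - W y' t| ≤ e t / K * d := by
      intro t ht
      have i1 := intervalIntegrable_of_mem (mul_integrable hℓ.le hp (hX y)) ht
      have i2 := intervalIntegrable_of_mem (mul_integrable hℓ.le hp (hX y')) ht
      obtain ⟨i3, h3⟩ := integral_abs_mul_exp_le hℓ.le hK0 hp ht
      have h1 : W y t - W y' t = ∫ s in (0 : ℝ)..t, p s * (X y s - X y' s) := by
        simp only [W, mul_sub]
        rw [intervalIntegral.integral_sub i1 i2]; ring
      rw [h1]
      have i5 : IntervalIntegrable (fun s => p s * (X y s - X y' s)) volume 0 t := by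
        simpa only [mul_sub] using i1.sub i2
      calc |∫ s in (0 : ℝ)..t, p s * (X y s - X y' s)|
          ≤ ∫ s in (0 : ℝ)..t, |p s * (X y s - X y' s)| :=
            intervalIntegral.abs_integral_le_integral_abs ht.1
        _ ≤ ∫ s in (0 : ℝ)..t, (|p s| * e s) * d := by
            refine intervalIntegral.integral_mono_on ht.1 i5.abs
              ((intervalIntegrable_of_mem i3 ht).mul_const d) fun s hs => ?_
            rw [abs_mul, mul_assoc]
            exact mul_le_mul_of_nonneg_left (hXd s ⟨hs.1, hs.2.trans ht.2⟩) (abs_nonneg _)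
        _ = (∫ s in (0 : ℝ)..t, |p s| * e s) * d := by
            rw [intervalIntegral.integral_mul_const]
        _ ≤ e t / K * d := mul_le_mul_of_nonneg_right h3 hd0
    have hZd : |Z y x - Z y' x| ≤ x * (e x / K * d) := by
      have h1 : Z y x - Z y' x = ∫ t in (0 : ℝ)..x, (W y t - W y' t) := by
        simp only [Z]
        rw [intervalIntegral.integral_sub (intervalIntegrable_of_mem (hWint y) hx)
          (intervalIntegrable_of_mem (hWint y') hx)]; ring
      rw [h1]
      have h2 := intervalIntegral.norm_integral_le_of_norm_le_const (a := 0) (b := x)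
        (f := fun t => W y t - W y' t) (C := e x / K * d) (by
          intro t ht
          rw [uIoc_of_le hx.1] at ht
          refine (hWd t ⟨ht.1.le, ht.2.trans hx.2⟩).trans ?_
          have := hemono t x ht.1.le ht.2 hx.2
          gcongr)
      rw [sub_zero, abs_of_nonneg hx.1, mul_comm] at h2
      exact h2
    have h9 : T y ⟨x, hx⟩ - T y' ⟨x, hx⟩ = (e x)⁻¹ * (Z y x - Z y' x) := by
      rw [hTapp, hTapp]; ring
    rw [Real.dist_eq, h9, abs_mul, abs_of_pos (inv_pos.mpr (Real.exp_pos _))]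
    calc (e x)⁻¹ * |Z y x - Z y' x| ≤ (e x)⁻¹ * (ℓ * (e x / K * d)) := by
          have : 0 < e x := Real.exp_pos _
          refine mul_le_mul_of_nonneg_left (hZd.trans ?_) (inv_pos.mpr this).le
          exact mul_le_mul_of_nonneg_right hx.2 (by positivity)
      _ = 1 / 2 * d := by
          have : e x ≠ 0 := (Real.exp_pos _).ne'
          rw [hK]; field_simp
      _ ≤ _ := by simp
  set y := hT.fixedPoint with hy
  have hfix : ∀ x ∈ Icc 0 ℓ, X y x = Z y x := by
    intro x hx
    have h1 : T y ⟨x, hx⟩ = y ⟨x, hx⟩ := by rw [hT.fixedPoint_isFixedPt]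
    have h2 : e x ≠ 0 := (Real.exp_pos _).ne'
    rw [hTapp] at h1
    simp only [X, IccExtend_of_mem _ _ hx, ← h1]
    field_simp
  refine ⟨Z y, W y, ⟨(hWZ y).2.1, (hWZ y).1, (hWZ y).2.2.2, ?_⟩, by simp [Z], by simp [W]⟩
  filter_upwards [(hWZ y).2.2.1] with x hx hx'
  rw [sub_zero, ← hfix x hx']
  exact hx hx'

/-- The solution `z` of `z'' = p z` on `[0, ℓ]` with `z(0) = a`, `z'(0) = b`, as the pair
`(z, z')`. It is the zero pair (a junk value) when there is no solution. -/
noncomputable def ivp (ℓ : ℝ) (p : ℝ → ℝ) (a b : ℝ) : (ℝ → ℝ) × (ℝ → ℝ) :=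
  open Classical in
  if h : ∃ y : (ℝ → ℝ) × (ℝ → ℝ), IsSystemSolution ℓ p (fun _ => 0) y.1 y.2 ∧ y.1 0 = a ∧ y.2 0 = b
  then h.choose else (0, 0)

theorem ivp_spec {ℓ : ℝ} (hℓ : 0 < ℓ) {p : ℝ → ℝ}
    (hp : IntervalIntegrable p volume 0 ℓ) (a b : ℝ) :
    IsSystemSolution ℓ p (fun _ => 0) (ivp ℓ p a b).1 (ivp ℓ p a b).2 ∧
      (ivp ℓ p a b).1 0 = a ∧ (ivp ℓ p a b).2 0 = b := by
  have h : ∃ y : (ℝ → ℝ) × (ℝ → ℝ),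
      IsSystemSolution ℓ p (fun _ => 0) y.1 y.2 ∧ y.1 0 = a ∧ y.2 0 = b := by
    obtain ⟨z, w, H⟩ := exists_isSystemSolution hℓ hp a b
    exact ⟨(z, w), H⟩
  rw [ivp, dif_pos h]
  exact h.choose_spec

/-! ### Continuous dependence on the potential -/

/-- Solutions of two homogeneous equations with the same initial data differ by at most a multiple
of the `L¹` distance of the coefficients. -/
theorem IsSystemSolution.dist_le {ℓ : ℝ} (hℓ : 0 ≤ ℓ) {p p' z w z' w' : ℝ → ℝ}
    (hp : IntervalIntegrable p volume 0 ℓ) (hp' : IntervalIntegrable p' volume 0 ℓ)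
    (h : IsSystemSolution ℓ p (fun _ => 0) z w) (h' : IsSystemSolution ℓ p' (fun _ => 0) z' w')
    (hz : z' 0 = z 0) (hw : w' 0 = w 0) {x : ℝ} (hx : x ∈ Icc 0 ℓ) :
    |z' x - z x| + |w' x - w x| ≤ (|z 0| + |w 0|) * Real.exp (ℓ + ∫ t in (0 : ℝ)..ℓ, |p t|) ^ 2 *
      ((∫ t in (0 : ℝ)..ℓ, |p' t - p t|) * Real.exp (∫ t in (0 : ℝ)..ℓ, |p' t - p t|)) := by
  have hd : IsSystemSolution ℓ p' (fun x => (p x - p' x) * z x)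
      (fun x => z' x - z x) (fun x => w' x - w x) :=
    (h'.sub (h.congr_equation (p' := p') (f' := fun x => (p' x - p x) * z x)
      fun x _ => by ring)).congr_equation fun x _ => by ring
  have hzc := h.continuousOn_fst hℓ
  have hi : IntervalIntegrable (fun x => (p x - p' x) * z x) volume 0 ℓ :=
    mul_integrable hℓ (hp.sub hp') hzc
  have hδ : IntervalIntegrable (fun t => |p' t - p t|) volume 0 ℓ := (hp'.sub hp).abs
  have h1 := hd.norm_le hℓ hp' hi x hx
  simp only [hz, hw, sub_self, abs_zero, zero_add] at h1
  set A := |z 0| + |w 0| with hA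
  set e := Real.exp (ℓ + ∫ t in (0 : ℝ)..ℓ, |p t|) with he
  set δ := ∫ t in (0 : ℝ)..ℓ, |p' t - p t| with hδdef
  have h2 : ∀ t ∈ Icc 0 ℓ, |z t| ≤ A * e := by
    intro t ht
    have := h.norm_le hℓ hp (by simp) t ht
    simp only [abs_zero, intervalIntegral.integral_zero, add_zero] at this
    linarith [abs_nonneg (w t)]
  have h3 : ∫ t in (0 : ℝ)..ℓ, |(p t - p' t) * z t| ≤ δ * (A * e) := by
    rw [hδdef, ← intervalIntegral.integral_mul_const]
    refine intervalIntegral.integral_mono_on hℓ hi.abs (hδ.mul_const _) fun t ht => ?_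
    rw [abs_mul, abs_sub_comm]
    exact mul_le_mul_of_nonneg_left (h2 t ht) (abs_nonneg _)
  have h4 : Real.exp (ℓ + ∫ t in (0 : ℝ)..ℓ, |p' t|) ≤ e * Real.exp δ := by
    rw [he, ← Real.exp_add, add_assoc]
    refine Real.exp_le_exp.mpr (add_le_add le_rfl ?_)
    rw [hδdef, ← intervalIntegral.integral_add hp.abs hδ]
    refine intervalIntegral.integral_mono_on hℓ hp'.abs (hp.abs.add hδ) fun t _ => ?_
    have := abs_add_le (p t) (p' t - p t)
    simpa using this
  have h5 : 0 ≤ ∫ t in (0 : ℝ)..ℓ, |(p t - p' t) * z t| :=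
    intervalIntegral.integral_nonneg hℓ fun t _ => abs_nonneg _
  calc _ ≤ _ := h1
    _ ≤ (δ * (A * e)) * (e * Real.exp δ) :=
        mul_le_mul h3 h4 (Real.exp_pos _).le (h5.trans h3)
    _ = _ := by ring

/-- Dominated convergence against a fixed integrable weight. -/
theorem tendsto_integral_mul {ι : Type*} {l : Filter ι} [l.IsCountablyGenerated] {ℓ : ℝ}
    (hℓ : 0 ≤ ℓ) {g : ℝ → ℝ} (hg : IntervalIntegrable g volume 0 ℓ) {F : ι → ℝ → ℝ} {F₀ : ℝ → ℝ}
    (hF : ∀ᶠ i in l, ContinuousOn (F i) (Icc 0 ℓ)) {C : ℝ}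
    (hC : ∀ᶠ i in l, ∀ x ∈ Icc 0 ℓ, |F i x| ≤ C)
    (hlim : ∀ x ∈ Icc 0 ℓ, Tendsto (fun i => F i x) l (𝓝 (F₀ x))) :
    Tendsto (fun i => ∫ x in (0 : ℝ)..ℓ, g x * F i x) l (𝓝 (∫ x in (0 : ℝ)..ℓ, g x * F₀ x)) := by
  refine intervalIntegral.tendsto_integral_filter_of_dominated_convergence
    (fun x => |g x| * C) ?_ ?_ (hg.abs.mul_const C) ?_
  · filter_upwards [hF] with i hi
    exact (intervalIntegrable_iff.mp (mul_integrable hℓ hg hi)).aestronglyMeasurable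
  · filter_upwards [hC] with i hi
    refine Eventually.of_forall fun x hx => ?_
    rw [uIoc_of_le hℓ] at hx
    rw [norm_mul]
    exact mul_le_mul_of_nonneg_left (hi x (Ioc_subset_Icc_self hx)) (abs_nonneg _)
  · refine Eventually.of_forall fun x hx => ?_
    rw [uIoc_of_le hℓ] at hx
    exact (hlim x (Ioc_subset_Icc_self hx)).const_mul _

/-- The coefficient `q + s h - lam` for the parameters `y = (lam, s)`. -/
def potential (q h : ℝ → ℝ) (y : ℝ × ℝ) (x : ℝ) : ℝ := q x + y.2 * h x - y.1

section Family

variable {ℓ : ℝ} {q h : ℝ → ℝ} (a b : ℝ)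

theorem potential_integrable (hq : IntervalIntegrable q volume 0 ℓ)
    (hh : IntervalIntegrable h volume 0 ℓ) (y : ℝ × ℝ) :
    IntervalIntegrable (potential q h y) volume 0 ℓ :=
  (hq.add (hh.const_mul y.2)).sub intervalIntegrable_const

theorem tendsto_potential (hℓ : 0 ≤ ℓ) (hh : IntervalIntegrable h volume 0 ℓ) (y₀ : ℝ × ℝ) :
    Tendsto (fun y => ∫ x in (0 : ℝ)..ℓ, |potential q h y x - potential q h y₀ x|) (𝓝 y₀)
      (𝓝 0) := by
  have h1 : Tendsto (fun y : ℝ × ℝ => |y.2 - y₀.2| * (∫ x in (0 : ℝ)..ℓ, |h x|) +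
      ℓ * |y.1 - y₀.1|) (𝓝 y₀) (𝓝 0) := by
    have : Continuous (fun y : ℝ × ℝ => |y.2 - y₀.2| * (∫ x in (0 : ℝ)..ℓ, |h x|) +
      ℓ * |y.1 - y₀.1|) := by fun_prop
    simpa using this.tendsto y₀
  have h2 : ∀ y x, potential q h y x - potential q h y₀ x =
      (y.2 - y₀.2) * h x - (y.1 - y₀.1) := fun y x => by simp only [potential]; ring
  refine squeeze_zero (fun y => intervalIntegral.integral_nonneg hℓ fun t _ => abs_nonneg _)
    (fun y => ?_) h1
  have h3 : (∫ x in (0 : ℝ)..ℓ, (|y.2 - y₀.2| * |h x| + |y.1 - y₀.1|)) =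
      |y.2 - y₀.2| * (∫ x in (0 : ℝ)..ℓ, |h x|) + ℓ * |y.1 - y₀.1| := by
    rw [intervalIntegral.integral_add (hh.abs.const_mul _) intervalIntegrable_const]
    simp
  rw [← h3]
  simp only [h2]
  refine intervalIntegral.integral_mono_on hℓ
    (((hh.const_mul _).sub intervalIntegrable_const).abs)
    ((hh.abs.const_mul _).add intervalIntegrable_const) fun x _ => ?_
  have := abs_sub ((y.2 - y₀.2) * h x) (y.1 - y₀.1)
  rwa [abs_mul] at this

/-- The solution of `z'' = (q + s h - lam) z` with initial data `(a, b)`, as the pair `(z, z')`,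
for the parameters `y = (lam, s)`. -/
noncomputable def shoot (ℓ : ℝ) (q h : ℝ → ℝ) (a b : ℝ) (y : ℝ × ℝ) : (ℝ → ℝ) × (ℝ → ℝ) :=
  ivp ℓ (potential q h y) a b

theorem shoot_spec (hℓ : 0 < ℓ) (hq : IntervalIntegrable q volume 0 ℓ)
    (hh : IntervalIntegrable h volume 0 ℓ) (y : ℝ × ℝ) :
    IsSystemSolution ℓ (potential q h y) (fun _ => 0) (shoot ℓ q h a b y).1
      (shoot ℓ q h a b y).2 ∧ (shoot ℓ q h a b y).1 0 = a ∧ (shoot ℓ q h a b y).2 0 = b :=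
  ivp_spec hℓ (potential_integrable hq hh y) a b

theorem shoot_continuousOn (hℓ : 0 < ℓ) (hq : IntervalIntegrable q volume 0 ℓ)
    (hh : IntervalIntegrable h volume 0 ℓ) (y : ℝ × ℝ) :
    ContinuousOn (shoot ℓ q h a b y).1 (Icc 0 ℓ) :=
  (shoot_spec a b hℓ hq hh y).1.continuousOn_fst hℓ.le

/-- The solutions depend continuously on the parameters, uniformly on `[0, ℓ]`. -/
theorem shoot_tendsto_uniform (hℓ : 0 < ℓ) (hq : IntervalIntegrable q volume 0 ℓ)
    (hh : IntervalIntegrable h volume 0 ℓ) (y₀ : ℝ × ℝ) {ε : ℝ} (hε : 0 < ε) :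
    ∀ᶠ y in 𝓝 y₀, ∀ x ∈ Icc 0 ℓ, |(shoot ℓ q h a b y).1 x - (shoot ℓ q h a b y₀).1 x| +
      |(shoot ℓ q h a b y).2 x - (shoot ℓ q h a b y₀).2 x| < ε := by
  have h1 := tendsto_potential (q := q) hℓ.le hh y₀
  have h2 := (h1.mul h1.rexp).const_mul ((|a| + |b|) *
    Real.exp (ℓ + ∫ t in (0 : ℝ)..ℓ, |potential q h y₀ t|) ^ 2)
  simp only [zero_mul, mul_zero] at h2
  filter_upwards [h2.eventually (gt_mem_nhds hε)] with y hy x hx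
  obtain ⟨s1, s2, s3⟩ := shoot_spec a b hℓ hq hh y
  obtain ⟨t1, t2, t3⟩ := shoot_spec a b hℓ hq hh y₀
  have := t1.dist_le hℓ.le (potential_integrable hq hh y₀) (potential_integrable hq hh y) s1
    (by rw [s2, t2]) (by rw [s3, t3]) hx
  rw [t2, t3] at this
  exact this.trans_lt hy

theorem shoot_continuous (hℓ : 0 < ℓ) (hq : IntervalIntegrable q volume 0 ℓ)
    (hh : IntervalIntegrable h volume 0 ℓ) {x : ℝ} (hx : x ∈ Icc 0 ℓ) :
    Continuous (fun y => (shoot ℓ q h a b y).1 x) ∧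
      Continuous (fun y => (shoot ℓ q h a b y).2 x) := by
  constructor
  · refine continuous_iff_continuousAt.mpr fun y₀ => Metric.tendsto_nhds.mpr fun ε hε => ?_
    filter_upwards [shoot_tendsto_uniform a b hℓ hq hh y₀ hε] with y hy
    exact (le_add_of_nonneg_right (abs_nonneg _)).trans_lt (hy x hx)
  · refine continuous_iff_continuousAt.mpr fun y₀ => Metric.tendsto_nhds.mpr fun ε hε => ?_
    filter_upwards [shoot_tendsto_uniform a b hℓ hq hh y₀ hε] with y hy
    exact (le_add_of_nonneg_left (abs_nonneg _)).trans_lt (hy x hx)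

theorem shoot_locally_bounded (hℓ : 0 < ℓ) (hq : IntervalIntegrable q volume 0 ℓ)
    (hh : IntervalIntegrable h volume 0 ℓ) (y₀ : ℝ × ℝ) :
    ∃ C, ∀ᶠ y in 𝓝 y₀, ∀ x ∈ Icc 0 ℓ, |(shoot ℓ q h a b y).1 x| ≤ C := by
  obtain ⟨C, hC⟩ := isCompact_Icc.exists_bound_of_continuousOn
    (shoot_continuousOn a b hℓ hq hh y₀)
  refine ⟨C + 1, ?_⟩
  filter_upwards [shoot_tendsto_uniform a b hℓ hq hh y₀ one_pos] with y hy x hx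
  have h1 := hy x hx
  have h2 := hC x hx
  rw [Real.norm_eq_abs] at h2
  have h3 := abs_sub_abs_le_abs_sub ((shoot ℓ q h a b y).1 x) ((shoot ℓ q h a b y₀).1 x)
  linarith [abs_nonneg ((shoot ℓ q h a b y).2 x - (shoot ℓ q h a b y₀).2 x)]

/-- Continuity of weighted scalar products of two solutions in both parameters. -/
theorem tendsto_integral_shoot_mul (hℓ : 0 < ℓ) (hq : IntervalIntegrable q volume 0 ℓ)
    (hh : IntervalIntegrable h volume 0 ℓ) {g : ℝ → ℝ} (hg : IntervalIntegrable g volume 0 ℓ)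
    (y₀ : ℝ × ℝ) :
    Tendsto (fun Y : (ℝ × ℝ) × (ℝ × ℝ) => ∫ x in (0 : ℝ)..ℓ,
        g x * ((shoot ℓ q h a b Y.1).1 x * (shoot ℓ q h a b Y.2).1 x)) (𝓝 (y₀, y₀))
      (𝓝 (∫ x in (0 : ℝ)..ℓ,
        g x * ((shoot ℓ q h a b y₀).1 x * (shoot ℓ q h a b y₀).1 x))) := by
  obtain ⟨C, hC⟩ := shoot_locally_bounded a b hℓ hq hh y₀
  refine tendsto_integral_mul hℓ.le hg (C := C * C) (Eventually.of_forall fun Y =>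
    (shoot_continuousOn a b hℓ hq hh _).mul (shoot_continuousOn a b hℓ hq hh _)) ?_ ?_
  · rw [nhds_prod_eq]
    filter_upwards [hC.prod_inl (𝓝 y₀), hC.prod_inr (𝓝 y₀)] with Y h1 h2 x hx
    rw [abs_mul]
    exact mul_le_mul (h1 x hx) (h2 x hx) (abs_nonneg _) ((abs_nonneg _).trans (h1 x hx))
  · intro x hx
    have := (shoot_continuous a b hℓ hq hh hx).1
    exact ((this.comp continuous_fst).mul (this.comp continuous_snd)).tendsto (y₀, y₀)

end Family

/-! ### The characteristic function -/

/-- For a nonzero vector `(c, s)`, the vectors `(u, v)` with `u c = v s` form a line. -/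
theorem exists_proportional {a b c s u v : ℝ} (hcs : c ^ 2 + s ^ 2 = 1) (hab : a ≠ 0 ∨ b ≠ 0)
    (h1 : a * c - b * s = 0) (h2 : u * c - v * s = 0) : ∃ k, u = k * a ∧ v = k * b := by
  have h3 : u * b - v * a = 0 := by
    have e1 : c * (u * b - v * a) = 0 := by linear_combination b * h2 - v * h1
    have e2 : s * (u * b - v * a) = 0 := by linear_combination a * h2 - u * h1
    linear_combination c * e1 + s * e2 - (u * b - v * a) * hcs
  have hpos : a ^ 2 + b ^ 2 ≠ 0 := by
    rcases hab with h | h <;> positivity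
  refine ⟨(u * a + v * b) / (a ^ 2 + b ^ 2), ?_, ?_⟩
  · field_simp; linear_combination b * h3
  · field_simp; linear_combination -a * h3

theorem IsEigenfunction.isSystemSolution {ℓ α β : ℝ} (hℓ : 0 < ℓ) {q z : ℝ → ℝ} {lam : ℝ}
    (h : IsEigenfunction ℓ α β q lam z) :
    IsSystemSolution ℓ (fun x => q x - lam) (fun _ => 0) z (dI ℓ z) := h.1.isSystemSolution hℓ

theorem IsEigenfunction.initial_ne_zero {ℓ α β : ℝ} (hℓ : 0 < ℓ) {q z : ℝ → ℝ} {lam : ℝ}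
    (hq : IntervalIntegrable q volume 0 ℓ) (h : IsEigenfunction ℓ α β q lam z) :
    z 0 ≠ 0 ∨ dI ℓ z 0 ≠ 0 := by
  by_contra! hc
  obtain ⟨x, hx, hne⟩ := h.2.2.2
  exact hne ((h.isSystemSolution hℓ).eq_zero hℓ.le (hq.sub intervalIntegrable_const) hc.1 hc.2 hx).1

theorem exists_ne_of_initial {ℓ : ℝ} (hℓ : 0 < ℓ) {p z w : ℝ → ℝ}
    (hz : IsSystemSolution ℓ p (fun _ => 0) z w) (h0 : z 0 ≠ 0 ∨ w 0 ≠ 0) :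
    ∃ x ∈ Icc 0 ℓ, z x ≠ 0 := by
  have hmem : (0 : ℝ) ∈ Icc 0 ℓ := ⟨le_rfl, hℓ.le⟩
  by_contra! hc
  rcases h0 with h1 | h1
  · exact h1 (hc 0 hmem)
  · apply h1
    rw [← hz.dI_eq hℓ hmem, dI, derivWithin_congr (fun y hy => hc y hy) (hc 0 hmem)]
    simp

/-- Eigenvalues are the zeros of the function that evaluates the boundary condition at `ℓ` on the
solution with fixed nonzero initial data satisfying the boundary condition at `0`. -/
theorem isEigenvalue_iff {ℓ α β : ℝ} (hℓ : 0 < ℓ) {q : ℝ → ℝ} {lam : ℝ}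
    (hq : IntervalIntegrable q volume 0 ℓ) {a b : ℝ} (hab : a ≠ 0 ∨ b ≠ 0)
    (hbc : a * Real.cos α - b * Real.sin α = 0) {z w : ℝ → ℝ}
    (h : IsSystemSolution ℓ (fun x => q x - lam) (fun _ => 0) z w) (hz0 : z 0 = a)
    (hw0 : w 0 = b) :
    IsEigenvalue ℓ α β q lam ↔ z ℓ * Real.cos β - w ℓ * Real.sin β = 0 := by
  have h0 : (0 : ℝ) ∈ Icc 0 ℓ := ⟨le_rfl, hℓ.le⟩
  have hl : ℓ ∈ Icc 0 ℓ := ⟨hℓ.le, le_rfl⟩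
  have hqi : IntervalIntegrable (fun x => q x - lam) volume 0 ℓ :=
    hq.sub intervalIntegrable_const
  constructor
  · rintro ⟨y, hy⟩
    have hys := hy.isSystemSolution hℓ
    obtain ⟨k, hk1, hk2⟩ := exists_proportional (Real.cos_sq_add_sin_sq α) hab hbc hy.2.1
    have hd := (hys.sub (h.const_mul k)).congr_equation (p' := fun x => q x - lam)
      (f' := fun _ => 0) (fun x _ => by ring)
    have hd0 := fun x hx => hd.eq_zero hℓ.le hqi (by rw [hz0, hk1]; ring) (by rw [hw0, hk2]; ring)
      (x := x) hx
    have hk : k ≠ 0 := by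
      rintro rfl
      rcases hy.initial_ne_zero hℓ hq with h1 | h1
      · exact h1 (by rw [hk1]; ring)
      · exact h1 (by rw [hk2]; ring)
    have hr : y ℓ * Real.cos β - dI ℓ y ℓ * Real.sin β = 0 := hy.2.2.1
    have e1 : y ℓ = k * z ℓ := by linarith [(hd0 ℓ hl).1]
    have e2 : dI ℓ y ℓ = k * w ℓ := by linarith [(hd0 ℓ hl).2]
    rw [e1, e2] at hr
    have : k * (z ℓ * Real.cos β - w ℓ * Real.sin β) = 0 := by linear_combination hr
    exact (mul_eq_zero.mp this).resolve_left hk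
  · intro hr
    refine ⟨z, h.isSolution hℓ, ?_, ?_, ?_⟩
    · rw [LeftBC, h.dI_eq hℓ h0, hz0, hw0]; exact hbc
    · rw [RightBC, h.dI_eq hℓ hl]; exact hr
    · exact exists_ne_of_initial hℓ h (by rwa [hz0, hw0])

theorem integral_sq_pos {ℓ : ℝ} (hℓ : 0 < ℓ) {z : ℝ → ℝ} (hz : ContinuousOn z (Icc 0 ℓ))
    {x : ℝ} (hx : x ∈ Icc 0 ℓ) (hne : z x ≠ 0) : 0 < ∫ t in (0 : ℝ)..ℓ, z t ^ 2 :=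
  intervalIntegral.integral_pos hℓ (hz.pow 2) (fun t _ => sq_nonneg _) ⟨x, hx, by positivity⟩

/-! ### A lower bound for the eigenvalues -/

/-- The trace inequality `sup z² ≤ ℓ⁻¹ ∫ z² + ∫ (η z'² + η⁻¹ z²)`. -/
theorem IsSystemSolution.sq_le {ℓ : ℝ} (hℓ : 0 < ℓ) {p f z w : ℝ → ℝ}
    (h : IsSystemSolution ℓ p f z w) {η : ℝ} (hη : 0 < η) {x : ℝ} (hx : x ∈ Icc 0 ℓ) :
    z x ^ 2 ≤ η * (∫ t in (0 : ℝ)..ℓ, w t ^ 2) + (1 / ℓ + 1 / η) * ∫ t in (0 : ℝ)..ℓ, z t ^ 2 := by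
  have hzi : IntervalIntegrable (fun t => z t ^ 2) volume 0 ℓ :=
    ((h.ac_fst.continuousOn).pow 2).intervalIntegrable
  have hwi : IntervalIntegrable (fun t => w t ^ 2) volume 0 ℓ :=
    ((h.ac_snd.continuousOn).pow 2).intervalIntegrable
  set B := η * (∫ t in (0 : ℝ)..ℓ, w t ^ 2) + (1 / η) * ∫ t in (0 : ℝ)..ℓ, z t ^ 2 with hB
  obtain ⟨hi, hftc⟩ := ftc_ac hℓ.le (h.ac_fst.fun_mul h.ac_fst)
    (F' := fun t => w t * z t + z t * w t) (by
      filter_upwards [h.deriv_fst] with t ht ht'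
      exact (ht ht').mul (ht ht'))
  have hsum : IntervalIntegrable (fun t => η * w t ^ 2 + 1 / η * z t ^ 2) volume 0 ℓ :=
    (hwi.const_mul _).add (hzi.const_mul _)
  have hpt : ∀ t, |w t * z t + z t * w t| ≤ η * w t ^ 2 + 1 / η * z t ^ 2 := by
    intro t
    have e1 : 0 ≤ (1 / η) * (η * w t - z t) ^ 2 := by positivity
    have e2 : 0 ≤ (1 / η) * (η * w t + z t) ^ 2 := by positivity
    have e3 : (1 / η) * (η * w t - z t) ^ 2 = η * w t ^ 2 + 1 / η * z t ^ 2 - 2 * (w t * z t) := by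
      field_simp; ring
    have e4 : (1 / η) * (η * w t + z t) ^ 2 = η * w t ^ 2 + 1 / η * z t ^ 2 + 2 * (w t * z t) := by
      field_simp; ring
    rw [abs_le]; constructor <;> linarith
  have hBint : ∫ t in (0 : ℝ)..ℓ, (η * w t ^ 2 + 1 / η * z t ^ 2) = B := by
    rw [intervalIntegral.integral_add (hwi.const_mul _) (hzi.const_mul _)]; simp [hB]
  have hdiff : ∀ y ∈ Icc 0 ℓ, z x ^ 2 ≤ z y ^ 2 + B := by
    intro y hy
    have i1 := intervalIntegrable_of_mem hi hx
    have i2 := intervalIntegrable_of_mem hi hy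
    have e1 : z x ^ 2 - z y ^ 2 = ∫ t in y..x, (w t * z t + z t * w t) := by
      rw [← intervalIntegral.integral_interval_sub_left i1 i2, hftc x hx, hftc y hy]; ring
    have e2 : |∫ t in y..x, (w t * z t + z t * w t)| ≤
        |(∫ t in y..x, |w t * z t + z t * w t|)| := by
      simpa only [Real.norm_eq_abs] using intervalIntegral.norm_integral_le_abs_integral_norm
        (f := fun t => w t * z t + z t * w t) (a := y) (b := x) (μ := volume)
    have e3 : |(∫ t in y..x, |w t * z t + z t * w t|)| ≤
        |(∫ t in (0 : ℝ)..ℓ, |w t * z t + z t * w t|)| := by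
      refine intervalIntegral.abs_integral_mono_interval ?_
        (Eventually.of_forall fun t => abs_nonneg _) hi.abs
      rw [uIoc_of_le hℓ.le]
      exact Ioc_subset_Ioc (le_min hy.1 hx.1) (max_le hy.2 hx.2)
    have e4 : |(∫ t in (0 : ℝ)..ℓ, |w t * z t + z t * w t|)| ≤ B := by
      rw [abs_of_nonneg (intervalIntegral.integral_nonneg hℓ.le fun t _ => abs_nonneg _), ← hBint]
      exact intervalIntegral.integral_mono_on hℓ.le hi.abs hsum fun t _ => hpt t
    linarith [le_abs_self (∫ t in y..x, (w t * z t + z t * w t))]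
  have hmean : ∫ _ in (0 : ℝ)..ℓ, z x ^ 2 ≤ ∫ y in (0 : ℝ)..ℓ, (z y ^ 2 + B) :=
    intervalIntegral.integral_mono_on hℓ.le intervalIntegrable_const
      (hzi.add intervalIntegrable_const) hdiff
  rw [intervalIntegral.integral_add hzi intervalIntegrable_const] at hmean
  simp only [intervalIntegral.integral_const, sub_zero, smul_eq_mul] at hmean
  have : z x ^ 2 ≤ (1 / ℓ) * (∫ t in (0 : ℝ)..ℓ, z t ^ 2) + B := by
    rw [← mul_le_mul_iff_right₀ hℓ]
    refine hmean.trans_eq ?_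
    field_simp
  rw [hB] at this
  linarith

/-- A boundary condition bounds the boundary term `z z'` by a multiple of `z²`. In the Dirichlet
case `s = 0` both sides vanish, and `c / s = 0` is harmless. -/
theorem abs_mul_le_of_bc {c s u v : ℝ} (hcs : c ^ 2 + s ^ 2 = 1) (h : u * c - v * s = 0) :
    |u * v| ≤ |c / s| * u ^ 2 := by
  by_cases hs : s = 0
  · subst hs
    have hc : c ≠ 0 := by rintro rfl; norm_num at hcs
    have hu : u = 0 := by simpa [hc] using h
    simp [hu]
  · have hv : v = c / s * u := by field_simp; linarith
    rw [hv, show u * (c / s * u) = c / s * u ^ 2 by ring, abs_mul, abs_of_nonneg (sq_nonneg u)]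

/-- The eigenvalues are bounded below in terms of the `L¹` norm of the potential. -/
theorem IsEigenvalue.lower_bound {ℓ α β : ℝ} (hℓ : 0 < ℓ) {q : ℝ → ℝ} {lam Q C : ℝ}
    (hq : IntervalIntegrable q volume 0 ℓ) (hQ : ∫ t in (0 : ℝ)..ℓ, |q t| ≤ Q)
    (hC : C = Q + |Real.cos α / Real.sin α| + |Real.cos β / Real.sin β|)
    (h : IsEigenvalue ℓ α β q lam) : -(C * (1 / ℓ + (C + 1))) ≤ lam := by
  obtain ⟨z, hz⟩ := h
  have hs := hz.isSystemSolution hℓ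
  have hzc := hs.continuousOn_fst hℓ.le
  obtain ⟨x, hx, hne⟩ := hz.2.2.2
  have hpos := integral_sq_pos hℓ hzc hx hne
  set w := dI ℓ z with hw
  have hQ0 : 0 ≤ Q :=
    (intervalIntegral.integral_nonneg hℓ.le fun t _ => abs_nonneg _).trans hQ
  have hC0 : 0 ≤ C := by rw [hC]; positivity
  have hzi : IntervalIntegrable (fun t => z t ^ 2) volume 0 ℓ :=
    ((hs.ac_fst.continuousOn).pow 2).intervalIntegrable
  have hwi : IntervalIntegrable (fun t => w t ^ 2) volume 0 ℓ :=
    ((hs.ac_snd.continuousOn).pow 2).intervalIntegrable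
  have hqz : IntervalIntegrable (fun t => q t * z t ^ 2) volume 0 ℓ :=
    mul_integrable hℓ.le hq (hzc.pow 2)
  -- With `η = 1 / (C + 1)` the term `C η ∫ z'²` is absorbed by `∫ z'²` in the energy identity.
  set S := 1 / (C + 1) * (∫ t in (0 : ℝ)..ℓ, w t ^ 2) +
    (1 / ℓ + 1 / (1 / (C + 1))) * ∫ t in (0 : ℝ)..ℓ, z t ^ 2 with hS
  have hsup : ∀ t ∈ Icc 0 ℓ, z t ^ 2 ≤ S := fun t ht => hs.sq_le hℓ (by positivity) ht
  have hS0 : 0 ≤ S := (sq_nonneg _).trans (hsup x hx)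
  have hen := hs.energy hℓ.le
  have hsplit : ∫ t in (0 : ℝ)..ℓ, (w t ^ 2 + (q t - lam) * z t ^ 2 - z t * 0) =
      (∫ t in (0 : ℝ)..ℓ, w t ^ 2) + (∫ t in (0 : ℝ)..ℓ, q t * z t ^ 2) -
        lam * ∫ t in (0 : ℝ)..ℓ, z t ^ 2 := by
    rw [← intervalIntegral.integral_add hwi hqz, ← intervalIntegral.integral_const_mul,
      ← intervalIntegral.integral_sub (hwi.add hqz) (hzi.const_mul _)]
    refine intervalIntegral.integral_congr fun t _ => ?_
    ring
  rw [hsplit] at hen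
  have hb0 : |z 0 * w 0| ≤ |Real.cos α / Real.sin α| * S :=
    (abs_mul_le_of_bc (Real.cos_sq_add_sin_sq α) hz.2.1).trans
      (mul_le_mul_of_nonneg_left (hsup 0 ⟨le_rfl, hℓ.le⟩) (abs_nonneg _))
  have hbl : |z ℓ * w ℓ| ≤ |Real.cos β / Real.sin β| * S :=
    (abs_mul_le_of_bc (Real.cos_sq_add_sin_sq β) hz.2.2.1).trans
      (mul_le_mul_of_nonneg_left (hsup ℓ ⟨hℓ.le, le_rfl⟩) (abs_nonneg _))
  have hqb : -(Q * S) ≤ ∫ t in (0 : ℝ)..ℓ, q t * z t ^ 2 := by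
    have e1 : |∫ t in (0 : ℝ)..ℓ, q t * z t ^ 2| ≤ Q * S :=
      calc |∫ t in (0 : ℝ)..ℓ, q t * z t ^ 2| ≤ ∫ t in (0 : ℝ)..ℓ, |q t * z t ^ 2| :=
            intervalIntegral.abs_integral_le_integral_abs hℓ.le
        _ ≤ ∫ t in (0 : ℝ)..ℓ, |q t| * S := by
            refine intervalIntegral.integral_mono_on hℓ.le hqz.abs (hq.abs.mul_const S)
              fun t ht => ?_
            rw [abs_mul, abs_of_nonneg (sq_nonneg (z t))]
            exact mul_le_mul_of_nonneg_left (hsup t ht) (abs_nonneg _)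
        _ = (∫ t in (0 : ℝ)..ℓ, |q t|) * S := by rw [intervalIntegral.integral_mul_const]
        _ ≤ Q * S := mul_le_mul_of_nonneg_right hQ hS0
    exact (abs_le.mp e1).1
  have hCS : (∫ t in (0 : ℝ)..ℓ, w t ^ 2) - lam * (∫ t in (0 : ℝ)..ℓ, z t ^ 2) ≤ C * S := by
    have e1 := (abs_le.mp hb0).1
    have e2 := (abs_le.mp hbl).2
    have e3 : C * S = Q * S + |Real.cos α / Real.sin α| * S + |Real.cos β / Real.sin β| * S := by
      rw [hC]; ring
    linarith
  have hw0 : 0 ≤ ∫ t in (0 : ℝ)..ℓ, w t ^ 2 :=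
    intervalIntegral.integral_nonneg hℓ.le fun t _ => sq_nonneg _
  have hCw : C * (1 / (C + 1) * ∫ t in (0 : ℝ)..ℓ, w t ^ 2) ≤ ∫ t in (0 : ℝ)..ℓ, w t ^ 2 := by
    rw [← mul_assoc, mul_one_div]
    exact mul_le_of_le_one_left hw0 ((div_le_one (by positivity)).mpr (by linarith))
  rw [hS, mul_add, one_div_one_div] at hCS
  have hfin : -(C * (1 / ℓ + (C + 1))) * (∫ t in (0 : ℝ)..ℓ, z t ^ 2) ≤
      lam * ∫ t in (0 : ℝ)..ℓ, z t ^ 2 := by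
    linarith
  exact le_of_mul_le_mul_right hfin hpos

/-! ### Stability of the number of zeros -/

/-- Let `D (·, s)` be a continuous family of functions whose zeros are bounded below. If the zeros
of `D (·, 0)` are sign changes near which each `D (·, s)` has at most one zero, then the `n`-th
zero persists for small `s`, remains the `n`-th one, and depends continuously on `s` at `0`. -/
theorem eventually_nth_zero {D : ℝ × ℝ → ℝ} (hD : Continuous D) {M Λ ε : ℝ} {n : ℕ} (hε : 0 < ε)
    (hM : ∀ᶠ s in 𝓝 (0 : ℝ), ∀ μ, D (μ, s) = 0 → M ≤ μ)
    (hsign : ∀ μ, D (μ, 0) = 0 → ∀ᶠ r in 𝓝[>] (0 : ℝ), D (μ - r, 0) * D (μ + r, 0) < 0)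
    (huniq : ∀ μ, D (μ, 0) = 0 → ∃ r > 0, ∀ᶠ s in 𝓝 (0 : ℝ), ∀ ν ∈ Ioo (μ - r) (μ + r),
      ∀ ν' ∈ Ioo (μ - r) (μ + r), D (ν, s) = 0 → D (ν', s) = 0 → ν = ν')
    (hΛ : D (Λ, 0) = 0) (hn : {μ | D (μ, 0) = 0 ∧ μ < Λ}.encard = n) :
    ∀ᶠ s in 𝓝 (0 : ℝ), ∃ Λ', D (Λ', s) = 0 ∧ |Λ' - Λ| < ε ∧
      {μ | D (μ, s) = 0 ∧ μ < Λ'}.encard = n := by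
  set Z : Set ℝ := insert Λ {μ | D (μ, 0) = 0 ∧ μ < Λ} with hZ
  have hZfin : Z.Finite := (Set.finite_of_encard_eq_coe hn).insert Λ
  have hZD : ∀ μ ∈ Z, D (μ, 0) = 0 := by
    rintro μ (rfl | h)
    exacts [hΛ, h.1]
  have hZle : ∀ μ ∈ Z, μ ≤ Λ := by
    rintro μ (rfl | h)
    exacts [le_rfl, h.2.le]
  -- A radius that isolates the zeros up to `Λ` from each other.
  have hr : ∀ᶠ r in 𝓝[>] (0 : ℝ), 0 < r ∧ r < ε ∧ ∀ μ ∈ Z,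
      (D (μ - r, 0) * D (μ + r, 0) < 0) ∧ (∀ᶠ s in 𝓝 (0 : ℝ), ∀ ν ∈ Icc (μ - r) (μ + r),
        ∀ ν' ∈ Icc (μ - r) (μ + r), D (ν, s) = 0 → D (ν', s) = 0 → ν = ν') ∧
      ∀ μ' ∈ Z, μ ≠ μ' → 2 * r < |μ - μ'| := by
    have small : ∀ c : ℝ, 0 < c → ∀ᶠ r in 𝓝[>] (0 : ℝ), r < c := fun c hc =>
      nhdsWithin_le_nhds (gt_mem_nhds hc)
    refine (eventually_mem_nhdsWithin).and ((small ε hε).and ?_)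
    rw [eventually_all_finite hZfin]
    intro μ hμ
    refine (hsign μ (hZD μ hμ)).and (Eventually.and ?_ ?_)
    · obtain ⟨ρ, hρ, H⟩ := huniq μ (hZD μ hμ)
      filter_upwards [small ρ hρ] with r hr
      have hsub : Icc (μ - r) (μ + r) ⊆ Ioo (μ - ρ) (μ + ρ) :=
        Icc_subset_Ioo (by linarith) (by linarith)
      filter_upwards [H] with s hs ν hν ν' hν'
      exact hs ν (hsub hν) ν' (hsub hν')
    · rw [eventually_all_finite hZfin]
      intro μ' _
      by_cases hne : μ = μ'
      · exact Eventually.of_forall fun r h => absurd hne h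
      · filter_upwards [small (|μ - μ'| / 2) (half_pos (abs_pos.mpr (sub_ne_zero.mpr hne)))]
          with r hr _
        linarith
  obtain ⟨r, hr0, hrε, hr⟩ := hr.exists
  have hDs : ∀ μ, Continuous fun s => D (μ, s) := fun μ => hD.comp (by fun_prop)
  have hDμ : ∀ s, Continuous fun μ => D (μ, s) := fun s => hD.comp (by fun_prop)
  have hexists : ∀ᶠ s in 𝓝 (0 : ℝ), ∀ μ ∈ Z, ∃ ν ∈ Ioo (μ - r) (μ + r), D (ν, s) = 0 := by
    rw [eventually_all_finite hZfin]
    intro μ hμ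
    have h1 : ∀ᶠ s in 𝓝 (0 : ℝ), D (μ - r, s) * D (μ + r, s) < 0 :=
      (((hDs (μ - r)).mul (hDs (μ + r))).tendsto 0).eventually (gt_mem_nhds (hr μ hμ).1)
    filter_upwards [h1] with s hs
    have hle : μ - r ≤ μ + r := by linarith
    rcases mul_neg_iff.mp hs with ⟨h2, h3⟩ | ⟨h2, h3⟩
    · exact intermediate_value_Ioo' hle (hDμ s).continuousOn ⟨h3, h2⟩
    · exact intermediate_value_Ioo hle (hDμ s).continuousOn ⟨h2, h3⟩
  have hunique : ∀ᶠ s in 𝓝 (0 : ℝ), ∀ μ ∈ Z, ∀ ν ∈ Icc (μ - r) (μ + r),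
      ∀ ν' ∈ Icc (μ - r) (μ + r), D (ν, s) = 0 → D (ν', s) = 0 → ν = ν' := by
    rw [eventually_all_finite hZfin]
    exact fun μ hμ => (hr μ hμ).2.1
  -- By compactness no zeros appear away from the intervals.
  have hcompact : ∀ᶠ s in 𝓝 (0 : ℝ), ∀ μ ∈ Icc M Λ \ ⋃ ν ∈ Z, Ioo (ν - r) (ν + r),
      D (μ, s) ≠ 0 := by
    have hK : IsCompact (Icc M Λ \ ⋃ ν ∈ Z, Ioo (ν - r) (ν + r)) :=
      isCompact_Icc.diff (isOpen_biUnion fun _ _ => isOpen_Ioo)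
    refine hK.eventually_forall_of_forall_eventually fun μ hμ => ?_
    have h0 : D (μ, 0) ≠ 0 := by
      intro h0
      refine hμ.2 (mem_iUnion₂.mpr ⟨μ, ?_, by constructor <;> linarith⟩)
      rcases hμ.1.2.lt_or_eq with h | h
      · exact Or.inr ⟨h0, h⟩
      · exact Or.inl h
    exact (hD.comp continuous_swap).continuousAt.eventually_ne h0
  filter_upwards [hM, hexists, hunique, hcompact] with s hM hex hun hcp
  have hΛZ : Λ ∈ Z := mem_insert _ _
  have hex' : ∀ μ, ∃ ν, μ ∈ Z → ν ∈ Ioo (μ - r) (μ + r) ∧ D (ν, s) = 0 := by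
    intro μ
    by_cases h : μ ∈ Z
    · obtain ⟨ν, h1, h2⟩ := hex μ h
      exact ⟨ν, fun _ => ⟨h1, h2⟩⟩
    · exact ⟨0, fun h' => absurd h' h⟩
  choose g hg using hex'
  have hgΛ := hg Λ hΛZ
  refine ⟨g Λ, hgΛ.2, ?_, ?_⟩
  · rw [abs_lt]; constructor <;> linarith [hgΛ.1.1, hgΛ.1.2]
  have himage : {μ | D (μ, s) = 0 ∧ μ < g Λ} = g '' {μ | D (μ, 0) = 0 ∧ μ < Λ} := by
    ext ν
    constructor
    · rintro ⟨h1, h2⟩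
      have h3 : ∃ μ ∈ Z, ν ∈ Ioo (μ - r) (μ + r) := by
        by_cases h4 : ν ≤ Λ
        · by_contra! h5
          refine hcp ν ⟨⟨hM ν h1, h4⟩, ?_⟩ h1
          simpa only [mem_iUnion₂, not_exists] using h5
        · exact ⟨Λ, hΛZ, by linarith, by linarith [hgΛ.1.2]⟩
      obtain ⟨μ, hμ, hν⟩ := h3
      have h4 : g μ = ν := hun μ hμ _ (Ioo_subset_Icc_self (hg μ hμ).1) _
        (Ioo_subset_Icc_self hν) (hg μ hμ).2 h1
      rcases hμ with rfl | hμ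
      · exact absurd h4 h2.ne'
      · exact ⟨μ, hμ, h4⟩
    · rintro ⟨μ, hμ, rfl⟩
      have hμZ : μ ∈ Z := Or.inr hμ
      have h1 := (hr μ hμZ).2.2 Λ hΛZ hμ.2.ne
      rw [abs_sub_comm, abs_of_pos (sub_pos.mpr hμ.2)] at h1
      exact ⟨(hg μ hμZ).2, by linarith [(hg μ hμZ).1.2, hgΛ.1.1]⟩
  have hinj : InjOn g {μ | D (μ, 0) = 0 ∧ μ < Λ} := by
    intro μ hμ μ' hμ' he
    by_contra hne
    have h1 := (hr μ (Or.inr hμ)).2.2 μ' (Or.inr hμ') hne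
    have h2 := (hg μ (Or.inr hμ)).1
    have h3 := (hg μ' (Or.inr hμ')).1
    rw [he] at h2
    have h4 : |μ - μ'| < 2 * r := by
      rw [abs_lt]; constructor <;> linarith [h2.1, h2.2, h3.1, h3.2]
    linarith
  rw [himage, hinj.encard_image, hn]

/-! ### Persistence and continuity of the `n`-th eigenvalue -/

section Persistence

variable {ℓ α β : ℝ} {q h : ℝ → ℝ} {a b : ℝ}

theorem isEigenvalue_iff_shoot (hℓ : 0 < ℓ) (hq : IntervalIntegrable q volume 0 ℓ)
    (hh : IntervalIntegrable h volume 0 ℓ) (hab : a ≠ 0 ∨ b ≠ 0)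
    (hbc : a * Real.cos α - b * Real.sin α = 0) (lam s : ℝ) :
    IsEigenvalue ℓ α β (fun x => q x + s * h x) lam ↔
      (shoot ℓ q h a b (lam, s)).1 ℓ * Real.cos β - (shoot ℓ q h a b (lam, s)).2 ℓ * Real.sin β
        = 0 := by
  obtain ⟨h1, h2, h3⟩ := shoot_spec a b hℓ hq hh (lam, s)
  exact isEigenvalue_iff hℓ (hq.add (hh.const_mul s)) hab hbc h1 h2 h3

/-- Lagrange's identity for the solutions at two parameters, with the Wronskian at `ℓ` expressed
through the rotated boundary values. -/
theorem shoot_lagrange (hℓ : 0 < ℓ) (hq : IntervalIntegrable q volume 0 ℓ)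
    (hh : IntervalIntegrable h volume 0 ℓ) (y y' : ℝ × ℝ) :
    ∫ x in (0 : ℝ)..ℓ, ((y'.2 - y.2) * h x - (y'.1 - y.1)) *
        ((shoot ℓ q h a b y).1 x * (shoot ℓ q h a b y').1 x) =
      (shoot ℓ q h a b y).1 ℓ * (shoot ℓ q h a b y').2 ℓ -
        (shoot ℓ q h a b y).2 ℓ * (shoot ℓ q h a b y').1 ℓ := by
  obtain ⟨h1, h2, h3⟩ := shoot_spec a b hℓ hq hh y
  obtain ⟨k1, k2, k3⟩ := shoot_spec a b hℓ hq hh y'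
  have := h1.lagrange hℓ.le k1
  rw [h2, h3, k2, k3] at this
  have e : a * b - b * a = 0 := by ring
  rw [e, sub_zero] at this
  rw [← this]
  refine intervalIntegral.integral_congr fun x _ => ?_
  simp only [potential]
  ring

theorem integral_shoot_sq_pos (hℓ : 0 < ℓ) (hq : IntervalIntegrable q volume 0 ℓ)
    (hh : IntervalIntegrable h volume 0 ℓ) (hab : a ≠ 0 ∨ b ≠ 0) (y : ℝ × ℝ) :
    0 < ∫ x in (0 : ℝ)..ℓ, (shoot ℓ q h a b y).1 x ^ 2 := by
  obtain ⟨h1, h2, h3⟩ := shoot_spec a b hℓ hq hh y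
  obtain ⟨x, hx, hne⟩ := exists_ne_of_initial hℓ h1 (by rwa [h2, h3])
  exact integral_sq_pos hℓ (h1.continuousOn_fst hℓ.le) hx hne

theorem eventually_integral_shoot_mul_pos (hℓ : 0 < ℓ) (hq : IntervalIntegrable q volume 0 ℓ)
    (hh : IntervalIntegrable h volume 0 ℓ) (hab : a ≠ 0 ∨ b ≠ 0) (y : ℝ × ℝ) :
    ∀ᶠ Y in 𝓝 (y, y), 0 < ∫ x in (0 : ℝ)..ℓ,
      (shoot ℓ q h a b Y.1).1 x * (shoot ℓ q h a b Y.2).1 x := by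
  have h1 := tendsto_integral_shoot_mul a b hℓ hq hh
    (g := fun _ => 1) intervalIntegrable_const y
  have h2 := integral_shoot_sq_pos hℓ hq hh hab y
  simp only [one_mul, ← pow_two] at h1
  exact h1.eventually (lt_mem_nhds h2)

/-- The `n`-th eigenvalue of `q + s h` exists for all small `s` and is close to that of `q`. -/
theorem IsNthEigenvalue.eventually_exists (hℓ : 0 < ℓ) (hq : IntervalIntegrable q volume 0 ℓ)
    (hh : IntervalIntegrable h volume 0 ℓ) (hab : a ≠ 0 ∨ b ≠ 0)
    (hbc : a * Real.cos α - b * Real.sin α = 0) {n : ℕ} {Λ : ℝ}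
    (hΛ : IsNthEigenvalue ℓ α β q n Λ) {ε : ℝ} (hε : 0 < ε) :
    ∀ᶠ s in 𝓝 (0 : ℝ), ∃ Λ', IsNthEigenvalue ℓ α β (fun x => q x + s * h x) n Λ' ∧
      |Λ' - Λ| < ε := by
  set D : ℝ × ℝ → ℝ := fun y => (shoot ℓ q h a b y).1 ℓ * Real.cos β -
    (shoot ℓ q h a b y).2 ℓ * Real.sin β with hDdef
  set N : ℝ × ℝ → ℝ := fun y => (shoot ℓ q h a b y).1 ℓ * Real.sin β +
    (shoot ℓ q h a b y).2 ℓ * Real.cos β with hNdef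
  have hl : ℓ ∈ Icc 0 ℓ := ⟨hℓ.le, le_rfl⟩
  have hDc : Continuous D :=
    ((shoot_continuous a b hℓ hq hh hl).1.mul_const _).sub
      ((shoot_continuous a b hℓ hq hh hl).2.mul_const _)
  have hiff : ∀ μ s, IsEigenvalue ℓ α β (fun x => q x + s * h x) μ ↔ D (μ, s) = 0 :=
    fun μ s => isEigenvalue_iff_shoot hℓ hq hh hab hbc μ s
  have hiff0 : ∀ μ, IsEigenvalue ℓ α β q μ ↔ D (μ, 0) = 0 := by
    intro μ; rw [← hiff μ 0]; simp
  -- The rotation `(z, z') ↦ (D, N)` preserves the Wronskian.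
  have hwr : ∀ μ ν s, D (μ, s) * N (ν, s) - N (μ, s) * D (ν, s) =
      (μ - ν) * ∫ x in (0 : ℝ)..ℓ,
        (shoot ℓ q h a b (μ, s)).1 x * (shoot ℓ q h a b (ν, s)).1 x := by
    intro μ ν s
    have h1 := shoot_lagrange (a := a) (b := b) hℓ hq hh (μ, s) (ν, s)
    simp only [sub_self, zero_mul, zero_sub, neg_sub] at h1
    rw [intervalIntegral.integral_const_mul] at h1
    rw [h1]
    simp only [hDdef, hNdef]
    linear_combination ((shoot ℓ q h a b (μ, s)).1 ℓ * (shoot ℓ q h a b (ν, s)).2 ℓ -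
      (shoot ℓ q h a b (μ, s)).2 ℓ * (shoot ℓ q h a b (ν, s)).1 ℓ) * Real.cos_sq_add_sin_sq β
  have hpos := eventually_integral_shoot_mul_pos (h := h) (a := a) (b := b) hℓ hq hh hab
  have hn : {μ | D (μ, 0) = 0 ∧ μ < Λ}.encard = n := by
    rw [← hΛ.2]; simp only [hiff0]
  have hM : ∃ M, ∀ᶠ s in 𝓝 (0 : ℝ), ∀ μ, D (μ, s) = 0 → M ≤ μ := by
    set C := (∫ t in (0 : ℝ)..ℓ, |q t|) + (∫ t in (0 : ℝ)..ℓ, |h t|) +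
      |Real.cos α / Real.sin α| + |Real.cos β / Real.sin β| with hC
    refine ⟨-(C * (1 / ℓ + (C + 1))), ?_⟩
    have h1 : ∀ᶠ s in 𝓝 (0 : ℝ), |s| < 1 := by
      have : Tendsto (fun s : ℝ => |s|) (𝓝 0) (𝓝 0) := by simpa using continuous_abs.tendsto (0:ℝ)
      exact this.eventually (gt_mem_nhds one_pos)
    filter_upwards [h1] with s hs μ hμ
    refine IsEigenvalue.lower_bound (Q := (∫ t in (0 : ℝ)..ℓ, |q t|) + ∫ t in (0 : ℝ)..ℓ, |h t|)
      hℓ (hq.add (hh.const_mul s)) ?_ hC ((hiff μ s).mpr hμ)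
    rw [← intervalIntegral.integral_add hq.abs hh.abs]
    refine intervalIntegral.integral_mono_on hℓ.le (hq.add (hh.const_mul s)).abs
      (hq.abs.add hh.abs) fun t _ => ?_
    refine (abs_add_le _ _).trans (add_le_add le_rfl ?_)
    rw [abs_mul]
    exact mul_le_of_le_one_left (abs_nonneg _) hs.le
  obtain ⟨M, hM⟩ := hM
  have key := eventually_nth_zero hDc hε hM ?_ ?_ ((hiff0 Λ).mp hΛ.1) hn
  · filter_upwards [key] with s hs
    obtain ⟨Λ', h1, h2, h3⟩ := hs
    refine ⟨Λ', ⟨(hiff Λ' s).mpr h1, ?_⟩, h2⟩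
    rw [← h3]; simp only [hiff]
  · intro μ hμ
    have h1 : Tendsto (fun r : ℝ => (((μ - r, 0), (μ, 0)) : (ℝ × ℝ) × (ℝ × ℝ))) (𝓝[>] 0)
        (𝓝 ((μ, 0), (μ, 0))) := by
      have : Continuous (fun r : ℝ => (((μ - r, 0), (μ, 0)) : (ℝ × ℝ) × (ℝ × ℝ))) := by fun_prop
      simpa using (this.tendsto 0).mono_left nhdsWithin_le_nhds
    have h2 : Tendsto (fun r : ℝ => (((μ + r, 0), (μ, 0)) : (ℝ × ℝ) × (ℝ × ℝ))) (𝓝[>] 0)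
        (𝓝 ((μ, 0), (μ, 0))) := by
      have : Continuous (fun r : ℝ => (((μ + r, 0), (μ, 0)) : (ℝ × ℝ) × (ℝ × ℝ))) := by fun_prop
      simpa using (this.tendsto 0).mono_left nhdsWithin_le_nhds
    filter_upwards [h1.eventually (hpos (μ, 0)), h2.eventually (hpos (μ, 0)),
      eventually_mem_nhdsWithin] with r i1 i2 hr
    have hr : 0 < r := hr
    have w1 := hwr (μ - r) μ 0
    have w2 := hwr (μ + r) μ 0
    rw [hμ] at w1 w2
    have e1 : D (μ - r, 0) * N (μ, 0) < 0 := by nlinarith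
    have e2 : 0 < D (μ + r, 0) * N (μ, 0) := by nlinarith
    have e3 := mul_neg_of_neg_of_pos e1 e2
    have e4 : D (μ - r, 0) * N (μ, 0) * (D (μ + r, 0) * N (μ, 0)) =
      (D (μ - r, 0) * D (μ + r, 0)) * N (μ, 0) ^ 2 := by ring
    rw [e4] at e3
    exact neg_of_mul_neg_left e3 (sq_nonneg _)
  · intro μ _
    obtain ⟨r, hr, H⟩ := Metric.eventually_nhds_iff.mp (hpos (μ, 0))
    refine ⟨r, hr, ?_⟩
    filter_upwards [Metric.ball_mem_nhds (0 : ℝ) hr] with s hs ν hν ν' hν' hz hz'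
    rw [Metric.mem_ball, Real.dist_eq, sub_zero] at hs
    have hI := H (y := ((ν, s), (ν', s))) (by
      simp only [Prod.dist_eq, Real.dist_eq, sub_zero, max_lt_iff]
      have e1 : |ν - μ| < r := abs_lt.mpr ⟨by linarith [hν.1], by linarith [hν.2]⟩
      have e2 : |ν' - μ| < r := abs_lt.mpr ⟨by linarith [hν'.1], by linarith [hν'.2]⟩
      exact ⟨⟨e1, hs⟩, e2, hs⟩)
    have hW := hwr ν ν' s
    rw [hz, hz', zero_mul, mul_zero, sub_self] at hW
    rcases mul_eq_zero.mp hW.symm with h1 | h1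
    · linarith
    · exact absurd h1 hI.ne'

end Persistence

/-! ### The first derivative of the eigenvalue -/

section Derivatives

variable {ℓ α β : ℝ} {q h : ℝ → ℝ} {a b : ℝ} {n : ℕ} {Λ : ℝ}

theorem IsNthEigenvalue.eventually_eigenvalueAlong (hℓ : 0 < ℓ)
    (hq : IntervalIntegrable q volume 0 ℓ) (hh : IntervalIntegrable h volume 0 ℓ)
    (hab : a ≠ 0 ∨ b ≠ 0) (hbc : a * Real.cos α - b * Real.sin α = 0)
    (hΛ : IsNthEigenvalue ℓ α β q n Λ) :
    eigenvalueAlong ℓ α β n q h 0 = Λ ∧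
    (∀ᶠ s in 𝓝 (0 : ℝ), IsNthEigenvalue ℓ α β (fun x => q x + s * h x) n
      (eigenvalueAlong ℓ α β n q h s)) ∧
    Tendsto (eigenvalueAlong ℓ α β n q h) (𝓝 0) (𝓝 Λ) := by
  refine ⟨?_, ?_, Metric.tendsto_nhds.mpr fun ε hε => ?_⟩
  · simp only [eigenvalueAlong, zero_mul, add_zero]
    exact hΛ.nthEigenvalue_eq
  · filter_upwards [hΛ.eventually_exists hℓ hq hh hab hbc one_pos] with s ⟨Λ', h1, _⟩
    rw [eigenvalueAlong, h1.nthEigenvalue_eq]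
    exact h1
  · filter_upwards [hΛ.eventually_exists hℓ hq hh hab hbc hε] with s ⟨Λ', h1, h2⟩
    rw [eigenvalueAlong, h1.nthEigenvalue_eq, Real.dist_eq]
    exact h2

/-- Two vectors satisfying the same boundary condition are linearly dependent. -/
theorem wronskian_eq_zero {c s u v u' v' : ℝ} (hcs : c ^ 2 + s ^ 2 = 1) (h : u * c - v * s = 0)
    (h' : u' * c - v' * s = 0) : u * v' - v * u' = 0 := by
  have e1 : c * (u * v' - v * u') = 0 := by linear_combination v' * h - v * h'
  have e2 : s * (u * v' - v * u') = 0 := by linear_combination u' * h - u * h'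
  linear_combination c * e1 + s * e2 - (u * v' - v * u') * hcs

/-- By Lagrange's identity the difference quotient of the eigenvalue at `s` is
`∫ h φ₀ φₛ / ∫ φ₀ φₛ`, so continuity of `φₛ` in `s` alone gives the derivative. -/
theorem IsNthEigenvalue.hasDerivAt_zero (hℓ : 0 < ℓ)
    (hq : IntervalIntegrable q volume 0 ℓ) (hh : IntervalIntegrable h volume 0 ℓ)
    (hab : a ≠ 0 ∨ b ≠ 0) (hbc : a * Real.cos α - b * Real.sin α = 0)
    (hΛ : IsNthEigenvalue ℓ α β q n Λ) :
    HasDerivAt (eigenvalueAlong ℓ α β n q h)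
      ((∫ x in (0 : ℝ)..ℓ, h x * (shoot ℓ q h a b (Λ, 0)).1 x ^ 2) /
        ∫ x in (0 : ℝ)..ℓ, (shoot ℓ q h a b (Λ, 0)).1 x ^ 2) 0 := by
  obtain ⟨h0, hev, hlim⟩ := hΛ.eventually_eigenvalueAlong (h := h) hℓ hq hh hab hbc
  set lam := eigenvalueAlong ℓ α β n q h with hlam
  have hpair : Tendsto (fun s : ℝ => ((((Λ, 0) : ℝ × ℝ), (lam s, s)))) (𝓝 0)
      (𝓝 ((Λ, 0), (Λ, 0))) :=
    tendsto_const_nhds.prodMk_nhds (hlim.prodMk_nhds tendsto_id)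
  have hA := (tendsto_integral_shoot_mul a b hℓ hq hh hh (Λ, 0)).comp hpair
  have hB := (tendsto_integral_shoot_mul a b hℓ hq hh
    (g := fun _ => 1) intervalIntegrable_const (Λ, 0)).comp hpair
  have hpos := integral_shoot_sq_pos hℓ hq hh hab (Λ, 0)
  simp only [one_mul, ← pow_two] at hA hB
  rw [hasDerivAt_iff_tendsto_slope]
  refine ((hA.div hB hpos.ne').mono_left nhdsWithin_le_nhds).congr' ?_
  filter_upwards [nhdsWithin_le_nhds hev, eventually_mem_nhdsWithin,
    nhdsWithin_le_nhds (hB.eventually (lt_mem_nhds hpos))] with s hs hne hBs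
  have hne : s ≠ 0 := hne
  have h1 := shoot_lagrange (a := a) (b := b) hℓ hq hh (Λ, 0) (lam s, s)
  have d1 := (isEigenvalue_iff_shoot hℓ hq hh hab hbc (lam s) s).mp hs.1
  have d0 := (isEigenvalue_iff_shoot hℓ hq hh hab hbc Λ 0).mp (by simpa using hΛ.1)
  rw [wronskian_eq_zero (Real.cos_sq_add_sin_sq β) d0 d1] at h1
  simp only [Function.comp_apply, Pi.div_apply] at hBs ⊢
  have c0 := shoot_continuousOn a b hℓ hq hh (Λ, 0)
  have c1 := shoot_continuousOn a b hℓ hq hh (lam s, s)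
  have i1 : IntervalIntegrable (fun x => h x * ((shoot ℓ q h a b (Λ, 0)).1 x *
      (shoot ℓ q h a b (lam s, s)).1 x)) volume 0 ℓ := mul_integrable hℓ.le hh (c0.mul c1)
  have i2 : IntervalIntegrable (fun x => (shoot ℓ q h a b (Λ, 0)).1 x *
      (shoot ℓ q h a b (lam s, s)).1 x) volume 0 ℓ := by
    refine ContinuousOn.intervalIntegrable ?_
    rw [uIcc_of_le hℓ.le]; exact c0.mul c1
  have h2 : s * (∫ x in (0 : ℝ)..ℓ, h x * ((shoot ℓ q h a b (Λ, 0)).1 x *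
      (shoot ℓ q h a b (lam s, s)).1 x)) - (lam s - Λ) * (∫ x in (0 : ℝ)..ℓ,
      (shoot ℓ q h a b (Λ, 0)).1 x * (shoot ℓ q h a b (lam s, s)).1 x) = 0 := by
    refine Eq.trans ?_ h1
    rw [← intervalIntegral.integral_const_mul, ← intervalIntegral.integral_const_mul,
      ← intervalIntegral.integral_sub (i1.const_mul _) (i2.const_mul _)]
    refine intervalIntegral.integral_congr fun x _ => ?_
    ring
  rw [slope_def_field, h0, sub_zero, div_eq_div_iff hBs.ne' hne]
  linarith

theorem shoot_translate (t lam : ℝ) :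
    shoot ℓ (fun x => q x + t * h x) h a b (lam, 0) = shoot ℓ q h a b (lam, t) := by
  have : potential (fun x => q x + t * h x) h (lam, 0) = potential q h (lam, t) := by
    funext x; simp [potential]
  rw [shoot, shoot, this]

/-- The first derivative at a nearby parameter, obtained by moving the base potential. -/
theorem IsNthEigenvalue.hasDerivAt (hℓ : 0 < ℓ)
    (hq : IntervalIntegrable q volume 0 ℓ) (hh : IntervalIntegrable h volume 0 ℓ)
    (hab : a ≠ 0 ∨ b ≠ 0) (hbc : a * Real.cos α - b * Real.sin α = 0) {t : ℝ}
    (hΛ : IsNthEigenvalue ℓ α β (fun x => q x + t * h x) n Λ) :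
    HasDerivAt (eigenvalueAlong ℓ α β n q h)
      ((∫ x in (0 : ℝ)..ℓ, h x * (shoot ℓ q h a b (Λ, t)).1 x ^ 2) /
        ∫ x in (0 : ℝ)..ℓ, (shoot ℓ q h a b (Λ, t)).1 x ^ 2) t := by
  have h1 := hΛ.hasDerivAt_zero (a := a) (b := b) hℓ (hq.add (hh.const_mul t)) hh hab hbc
  rw [shoot_translate] at h1
  have h2 := HasDerivAt.comp_sub_const t t (by rwa [sub_self])
  refine h2.congr_of_eventuallyEq (Eventually.of_forall fun s => ?_)
  simp only [eigenvalueAlong]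
  congr 1
  funext x
  ring

/-! ### Differentiating the eigenfunction -/

/-- The solutions along the eigenvalue curve are differentiable in `s` at `0`, uniformly on
`[0, ℓ]`; the derivative solves the linearized initial value problem. -/
theorem tendsto_difference_quotient (hℓ : 0 < ℓ) (hq : IntervalIntegrable q volume 0 ℓ)
    (hh : IntervalIntegrable h volume 0 ℓ) {lam : ℝ → ℝ} {L : ℝ} (hlam : HasDerivAt lam L 0)
    {U W : ℝ → ℝ} (hU : IsSystemSolution ℓ (fun x => q x - lam 0)
      (fun x => -((shoot ℓ q h a b (lam 0, 0)).1 x * (h x - L))) U W)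
    (hU0 : U 0 = 0) (hW0 : W 0 = 0) {ε : ℝ} (hε : 0 < ε) :
    ∀ᶠ s in 𝓝[≠] (0 : ℝ), ∀ x ∈ Icc 0 ℓ, |s⁻¹ * ((shoot ℓ q h a b (lam s, s)).1 x -
      (shoot ℓ q h a b (lam 0, 0)).1 x) - U x| < ε := by
  set φ : ℝ → ℝ → ℝ := fun s => (shoot ℓ q h a b (lam s, s)).1 with hφ
  have hφc : ∀ s, ContinuousOn (φ s) (Icc 0 ℓ) := fun s => shoot_continuousOn a b hℓ hq hh _
  have hcurve : Tendsto (fun s => (lam s, s)) (𝓝 0) (𝓝 (lam 0, 0)) :=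
    hlam.continuousAt.tendsto.prodMk_nhds tendsto_id
  have hslope : Tendsto (slope lam 0) (𝓝[≠] 0) (𝓝 L) := hasDerivAt_iff_tendsto_slope.mp hlam
  -- Weighted `L¹` distances of the solutions tend to zero.
  have hdist : ∀ g : ℝ → ℝ, IntervalIntegrable g volume 0 ℓ →
      Tendsto (fun s => ∫ x in (0 : ℝ)..ℓ, g x * |φ s x - φ 0 x|) (𝓝[≠] 0) (𝓝 0) := by
    intro g hg
    have h1 := tendsto_integral_mul (l := 𝓝[≠] (0 : ℝ)) hℓ.le hg (C := 1)
      (F := fun s x => |φ s x - φ 0 x|) (F₀ := fun _ => 0)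
      (Eventually.of_forall fun s => ((hφc s).sub (hφc 0)).abs) ?_ ?_
    · simpa using h1
    · filter_upwards [nhdsWithin_le_nhds
        (hcurve.eventually (shoot_tendsto_uniform a b hℓ hq hh (lam 0, 0) one_pos))]
        with s hs x hx
      rw [abs_abs]
      exact (le_add_of_nonneg_right (abs_nonneg _)).trans (hs x hx).le
    · intro x hx
      have h2 : Tendsto (fun s => φ s x) (𝓝[≠] 0) (𝓝 (φ 0 x)) :=
        (((shoot_continuous a b hℓ hq hh hx).1.tendsto (lam 0, 0)).comp hcurve).mono_left
          nhdsWithin_le_nhds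
      simpa using (h2.sub_const (φ 0 x)).abs
  set c := Real.exp (ℓ + ∫ t in (0 : ℝ)..ℓ, |q t - lam 0|) with hc
  have hbound : Tendsto (fun s => ((∫ x in (0 : ℝ)..ℓ, |h x| * |φ s x - φ 0 x|) +
      |slope lam 0 s| * (∫ x in (0 : ℝ)..ℓ, 1 * |φ s x - φ 0 x|) +
      |slope lam 0 s - L| * ∫ x in (0 : ℝ)..ℓ, |φ 0 x|) * c) (𝓝[≠] 0) (𝓝 0) := by
    have h1 := (((hdist _ hh.abs).add (hslope.abs.mul (hdist (fun _ => 1)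
      intervalIntegrable_const))).add
      (((hslope.sub_const L).abs).mul_const (∫ x in (0 : ℝ)..ℓ, |φ 0 x|))).mul_const c
    simpa using h1
  filter_upwards [hbound.eventually (gt_mem_nhds hε), eventually_mem_nhdsWithin] with s hs hne x hx
  have hne : s ≠ 0 := hne
  refine lt_of_le_of_lt ?_ hs
  obtain ⟨s1, s2, s3⟩ := shoot_spec a b hℓ hq hh (lam s, s)
  obtain ⟨t1, t2, t3⟩ := shoot_spec a b hℓ hq hh (lam 0, 0)
  have hqi : IntervalIntegrable (fun x => q x - lam 0) volume 0 ℓ :=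
    hq.sub intervalIntegrable_const
  have hsl : slope lam 0 s = (lam s - lam 0) / s := by rw [slope_def_field, sub_zero]
  have e1 := (s1.congr_equation (p' := fun x => q x - lam 0)
    (f' := fun x => -((s * h x - (lam s - lam 0)) * φ s x))
    fun x _ => by simp only [potential, hφ]; ring)
  have e2 := (t1.congr_equation (p' := fun x => q x - lam 0) (f' := fun x => 0)
    fun x _ => by simp only [potential]; ring)
  have hd := (((e1.sub e2).const_mul s⁻¹).sub hU).congr_equation (p' := fun x => q x - lam 0)
    (f' := fun x => -((h x * (φ s x - φ 0 x) - slope lam 0 s * (φ s x - φ 0 x)) -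
      (slope lam 0 s - L) * φ 0 x)) fun x _ => by
        rw [hsl]
        simp only [hφ]
        field_simp
        ring
  have i0 : ∀ g : ℝ → ℝ, ContinuousOn g (Icc 0 ℓ) → IntervalIntegrable g volume 0 ℓ :=
    fun g hg => ContinuousOn.intervalIntegrable (by rwa [uIcc_of_le hℓ.le])
  have i1 : IntervalIntegrable (fun x => h x * (φ s x - φ 0 x)) volume 0 ℓ :=
    mul_integrable hℓ.le hh ((hφc s).sub (hφc 0))
  have i2 : IntervalIntegrable (fun x => φ s x - φ 0 x) volume 0 ℓ := i0 _ ((hφc s).sub (hφc 0))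
  have i3 := i0 _ (hφc 0)
  have hfi : IntervalIntegrable (fun x => -((h x * (φ s x - φ 0 x) -
      slope lam 0 s * (φ s x - φ 0 x)) - (slope lam 0 s - L) * φ 0 x)) volume 0 ℓ :=
    ((i1.sub (i2.const_mul _)).sub (i3.const_mul _)).neg
  have hb := hd.norm_le hℓ.le hqi hfi x hx
  simp only [s2, t2, s3, t3, hU0, hW0, sub_self, mul_zero, abs_zero, zero_add] at hb
  refine (le_add_of_nonneg_right (abs_nonneg _)).trans (hb.trans ?_)
  refine mul_le_mul_of_nonneg_right ?_ (Real.exp_pos _).le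
  have j1 : IntervalIntegrable (fun x => |h x| * |φ s x - φ 0 x|) volume 0 ℓ :=
    mul_integrable hℓ.le hh.abs ((hφc s).sub (hφc 0)).abs
  have j2 : IntervalIntegrable (fun x => 1 * |φ s x - φ 0 x|) volume 0 ℓ := by
    simpa using i2.abs
  rw [← intervalIntegral.integral_const_mul, ← intervalIntegral.integral_const_mul,
    ← intervalIntegral.integral_add j1 (j2.const_mul _),
    ← intervalIntegral.integral_add (j1.add (j2.const_mul _)) (i3.abs.const_mul _)]
  refine intervalIntegral.integral_mono_on hℓ.le hfi.abs
    ((j1.add (j2.const_mul _)).add (i3.abs.const_mul _)) fun x _ => ?_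
  rw [abs_neg, one_mul, ← abs_mul, ← abs_mul, ← abs_mul]
  exact (abs_sub _ _).trans (add_le_add (abs_sub _ _) le_rfl)

/-- Weighted square integrals of the solutions are differentiable along the eigenvalue curve. -/
theorem hasDerivAt_integral_sq (hℓ : 0 < ℓ) (hq : IntervalIntegrable q volume 0 ℓ)
    (hh : IntervalIntegrable h volume 0 ℓ) {lam : ℝ → ℝ} {L : ℝ} (hlam : HasDerivAt lam L 0)
    {U W : ℝ → ℝ} (hU : IsSystemSolution ℓ (fun x => q x - lam 0)
      (fun x => -((shoot ℓ q h a b (lam 0, 0)).1 x * (h x - L))) U W)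
    (hU0 : U 0 = 0) (hW0 : W 0 = 0) {g : ℝ → ℝ} (hg : IntervalIntegrable g volume 0 ℓ) :
    HasDerivAt (fun s => ∫ x in (0 : ℝ)..ℓ, g x * (shoot ℓ q h a b (lam s, s)).1 x ^ 2)
      (∫ x in (0 : ℝ)..ℓ, g x * (2 * (shoot ℓ q h a b (lam 0, 0)).1 x * U x)) 0 := by
  set φ : ℝ → ℝ → ℝ := fun s => (shoot ℓ q h a b (lam s, s)).1 with hφ
  have hφc : ∀ s, ContinuousOn (φ s) (Icc 0 ℓ) := fun s => shoot_continuousOn a b hℓ hq hh _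
  have hcurve : Tendsto (fun s => (lam s, s)) (𝓝[≠] 0) (𝓝 (lam 0, 0)) :=
    (hlam.continuousAt.tendsto.prodMk_nhds tendsto_id).mono_left nhdsWithin_le_nhds
  have hquot := fun {ε : ℝ} => tendsto_difference_quotient (ε := ε) hℓ hq hh hlam hU hU0 hW0
  obtain ⟨C, hC⟩ := shoot_locally_bounded a b hℓ hq hh (lam 0, 0)
  obtain ⟨C', hC'⟩ := isCompact_Icc.exists_bound_of_continuousOn (hU.continuousOn_fst hℓ.le)
  have hlim := tendsto_integral_mul (l := 𝓝[≠] (0 : ℝ)) hℓ.le hg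
    (F := fun s x => (φ s x + φ 0 x) * (s⁻¹ * (φ s x - φ 0 x)))
    (F₀ := fun x => 2 * φ 0 x * U x) (C := (C + C) * (C' + 1))
    (Eventually.of_forall fun s => ((hφc s).add (hφc 0)).mul
      (continuousOn_const.mul ((hφc s).sub (hφc 0)))) ?_ ?_
  · rw [hasDerivAt_iff_tendsto_slope]
    refine hlim.congr' ?_
    filter_upwards [] with s
    have i1 : ∀ r, IntervalIntegrable (fun x => g x * φ r x ^ 2) volume 0 ℓ :=
      fun r => mul_integrable hℓ.le hg ((hφc r).pow 2)
    rw [slope_def_field, sub_zero, ← intervalIntegral.integral_sub (i1 s) (i1 0), div_eq_inv_mul,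
      ← intervalIntegral.integral_const_mul]
    refine intervalIntegral.integral_congr fun x _ => ?_
    ring
  · filter_upwards [hquot one_pos, hcurve.eventually hC] with s h1 h2 x hx
    have h3 := hC.self_of_nhds x hx
    have h4 := hC' x hx
    rw [Real.norm_eq_abs] at h4
    rw [abs_mul]
    refine mul_le_mul ((abs_add_le _ _).trans (add_le_add (h2 x hx) h3)) ?_ (abs_nonneg _) ?_
    · have h5 := abs_sub_abs_le_abs_sub (s⁻¹ * (φ s x - φ 0 x)) (U x)
      linarith [h1 x hx]
    · linarith [abs_nonneg ((shoot ℓ q h a b (lam 0, 0)).1 x)]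
  · intro x hx
    have h1 : Tendsto (fun s => φ s x) (𝓝[≠] 0) (𝓝 (φ 0 x)) :=
      ((shoot_continuous a b hℓ hq hh hx).1.tendsto (lam 0, 0)).comp hcurve
    have h2 : Tendsto (fun s => s⁻¹ * (φ s x - φ 0 x)) (𝓝[≠] 0) (𝓝 (U x)) := by
      refine Metric.tendsto_nhds.mpr fun ε hε => ?_
      filter_upwards [hquot hε] with s hs
      exact hs x hx
    have h3 := (h1.add_const (φ 0 x)).mul h2
    rwa [← two_mul] at h3

/-- A nonzero solution does not vanish to first order at the right end-point. Otherwise Lagrange's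
identity would make it orthogonal to the solutions for all neighbouring spectral parameters. -/
theorem shoot_end_ne_zero (hℓ : 0 < ℓ) (hq : IntervalIntegrable q volume 0 ℓ)
    (hh : IntervalIntegrable h volume 0 ℓ) (hab : a ≠ 0 ∨ b ≠ 0) :
    (shoot ℓ q h a b (Λ, 0)).1 ℓ ≠ 0 ∨ (shoot ℓ q h a b (Λ, 0)).2 ℓ ≠ 0 := by
  by_contra! hc
  have h1 : Tendsto (fun r : ℝ => (((Λ + r, 0), (Λ, 0)) : (ℝ × ℝ) × (ℝ × ℝ))) (𝓝[≠] 0)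
      (𝓝 ((Λ, 0), (Λ, 0))) := by
    have : Continuous (fun r : ℝ => (((Λ + r, 0), (Λ, 0)) : (ℝ × ℝ) × (ℝ × ℝ))) := by fun_prop
    simpa using (this.tendsto 0).mono_left nhdsWithin_le_nhds
  obtain ⟨r, h2, h3⟩ := ((h1.eventually (eventually_integral_shoot_mul_pos hℓ hq hh hab
    (Λ, 0))).and eventually_mem_nhdsWithin).exists
  have h3 : r ≠ 0 := h3
  have h4 := shoot_lagrange (a := a) (b := b) hℓ hq hh (Λ + r, 0) (Λ, 0)
  rw [hc.1, hc.2, intervalIntegral.integral_congr (g := fun x => r *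
    ((shoot ℓ q h a b (Λ + r, 0)).1 x * (shoot ℓ q h a b (Λ, 0)).1 x))
    (fun x _ => by simp only; ring), intervalIntegral.integral_const_mul] at h4
  have : r * (∫ x in (0 : ℝ)..ℓ, (shoot ℓ q h a b (Λ + r, 0)).1 x *
    (shoot ℓ q h a b (Λ, 0)).1 x) ≠ 0 := mul_ne_zero h3 h2.ne'
  exact this (by linarith)

end Derivatives

end SturmLiouville

/-! ### The two derivatives -/

open SturmLiouville

theorem theorem1p2 (ℓ α β : ℝ) (hℓ : 0 < ℓ)
    (hα : α ∈ Set.Ico 0 Real.pi) (hβ : β ∈ Set.Ioc 0 Real.pi) (n : ℕ)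
    (q h : ℝ → ℝ)
    (hq : MeasureTheory.IntegrableOn q (Set.Icc 0 ℓ))
    (hh : MeasureTheory.IntegrableOn h (Set.Icc 0 ℓ))
    (E U : ℝ → ℝ)
    (hE : SturmLiouville.IsNthNormalizedEigenfunction ℓ α β q n E)
    (hU : SturmLiouville.IsUn ℓ α β n q h E U) :
    -- the number `L` in the equation for `U` is a genuine derivative
    HasDerivAt (SturmLiouville.eigenvalueAlong ℓ α β n q h)
      (∫ x in (0 : ℝ)..ℓ, E x ^ 2 * h x) 0 ∧
    -- (i)
    (SturmLiouville.LeftBC ℓ α U ∧ SturmLiouville.RightBC ℓ β U) ∧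
    -- (ii): `β = π` is the condition `z(ℓ) = 0`, `β = π / 2` is the condition `z'(ℓ) = 0`
    (β = Real.pi ∨ β = Real.pi / 2 →
      SturmLiouville.HasSecondDerivAt (SturmLiouville.eigenvalueAlong ℓ α β n q h)
        (-2 * ∫ x in (0 : ℝ)..ℓ, ((SturmLiouville.dI ℓ U x) ^ 2 +
          (q x - SturmLiouville.nthEigenvalue ℓ α β n q) * U x ^ 2)) 0) := by
  have h0 : (0 : ℝ) ∈ Icc 0 ℓ := ⟨le_rfl, hℓ.le⟩
  have hl : ℓ ∈ Icc 0 ℓ := ⟨hℓ.le, le_rfl⟩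
  have hqi : IntervalIntegrable q volume 0 ℓ :=
    (intervalIntegrable_iff_integrableOn_Icc_of_le hℓ.le).mpr hq
  have hhi : IntervalIntegrable h volume 0 ℓ :=
    (intervalIntegrable_iff_integrableOn_Icc_of_le hℓ.le).mpr hh
  obtain ⟨⟨Λ, hΛ, hEΛ⟩, hnorm, -⟩ := hE
  obtain ⟨hUsol, hU0, hU0'⟩ := hU
  have hab := hEΛ.initial_ne_zero hℓ hqi
  have hbc : E 0 * Real.cos α - dI ℓ E 0 * Real.sin α = 0 := hEΛ.2.1
  have hEs := hEΛ.isSystemSolution hℓ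
  obtain ⟨hlam0, hev, -⟩ := hΛ.eventually_eigenvalueAlong (h := h) hℓ hqi hhi hab hbc
  set lam := eigenvalueAlong ℓ α β n q h with hlam
  set φ := shoot ℓ q h (E 0) (dI ℓ E 0) with hφ
  -- The solution with the initial data of `E` is `E`.
  have hφE : ∀ x ∈ Icc 0 ℓ, (φ (Λ, 0)).1 x = E x ∧ (φ (Λ, 0)).2 x = dI ℓ E x := by
    intro x hx
    obtain ⟨s1, s2, s3⟩ := shoot_spec (E 0) (dI ℓ E 0) hℓ hqi hhi (Λ, 0)
    have hd := ((s1.congr_equation (p' := fun x => q x - Λ) (f' := fun _ => 0)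
      fun x _ => by simp only [potential]; ring).sub hEs).congr_equation
      (p' := fun x => q x - Λ) (f' := fun _ => 0) fun x _ => by ring
    have := hd.eq_zero hℓ.le (hqi.sub intervalIntegrable_const) (by rw [s2, sub_self])
      (by rw [s3, sub_self]) hx
    exact ⟨sub_eq_zero.mp this.1, sub_eq_zero.mp this.2⟩
  have hcongr : ∀ F G : ℝ → ℝ, (∀ x ∈ Icc 0 ℓ, F x = G x) →
      ∫ x in (0 : ℝ)..ℓ, F x = ∫ x in (0 : ℝ)..ℓ, G x := fun F G hFG =>
    intervalIntegral.integral_congr fun x hx => hFG x (by rwa [uIcc_of_le hℓ.le] at hx)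
  have hnormφ : ∫ x in (0 : ℝ)..ℓ, (φ (Λ, 0)).1 x ^ 2 = 1 := by
    rw [← hnorm]; exact hcongr _ _ fun x hx => by rw [(hφE x hx).1]
  set L := ∫ x in (0 : ℝ)..ℓ, E x ^ 2 * h x with hL
  have hLφ : ∫ x in (0 : ℝ)..ℓ, h x * (φ (Λ, 0)).1 x ^ 2 = L :=
    hcongr _ _ fun x hx => by rw [(hφE x hx).1, mul_comm]
  have hderiv : HasDerivAt lam L 0 := by
    have := hΛ.hasDerivAt_zero hℓ hqi hhi hab hbc
    rwa [hLφ, hnormφ, div_one] at this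
  have hUs : IsSystemSolution ℓ (fun x => q x - Λ) (fun x => -(E x * (h x - L))) U (dI ℓ U) := by
    have := hUsol.isSystemSolution hℓ
    rwa [hΛ.nthEigenvalue_eq, firstDerivative, hderiv.deriv] at this
  have hEc := hEs.continuousOn_fst hℓ.le
  have hUc := hUs.continuousOn_fst hℓ.le
  have hright : RightBC ℓ β U := by
    have h1 := hEs.lagrange hℓ.le hUs
    have i1 : IntervalIntegrable (fun x => E x ^ 2 * h x) volume 0 ℓ := by
      simpa only [mul_comm, Pi.pow_apply] using mul_integrable hℓ.le hhi (hEc.pow 2)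
    have i2 : IntervalIntegrable (fun x => L * E x ^ 2) volume 0 ℓ :=
      ContinuousOn.intervalIntegrable (by
        rw [uIcc_of_le hℓ.le]; exact continuousOn_const.mul (hEc.pow 2))
    have h2 : ∫ x in (0 : ℝ)..ℓ, ((q x - Λ - (q x - Λ)) * (E x * U x) -
        E x * -(E x * (h x - L)) + U x * 0) = 0 := by
      rw [hcongr _ (fun x => E x ^ 2 * h x - L * E x ^ 2) (fun x _ => by ring),
        intervalIntegral.integral_sub i1 i2, intervalIntegral.integral_const_mul, hnorm]
      simp [hL]
    rw [h2, hU0, hU0'] at h1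
    have hEr : E ℓ * Real.cos β - dI ℓ E ℓ * Real.sin β = 0 := hEΛ.2.2.1
    have hEne : E ℓ ≠ 0 ∨ dI ℓ E ℓ ≠ 0 := by
      have := shoot_end_ne_zero (Λ := Λ) hℓ hqi hhi hab
      rwa [← hφ, (hφE ℓ hl).1, (hφE ℓ hl).2] at this
    -- Both boundary vectors lie on the line orthogonal to `(cos β, -sin β)`.
    obtain ⟨k, hk1, hk2⟩ := exists_proportional (a := E ℓ) (b := dI ℓ E ℓ) (u := Real.sin β)
      (v := Real.cos β) (Real.cos_sq_add_sin_sq β) hEne hEr (by ring)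
    rw [RightBC, hk1, hk2]
    linear_combination k * h1
  refine ⟨hderiv, ⟨?_, hright⟩, fun hβ' => ⟨?_, ?_⟩⟩
  · rw [LeftBC, hU0, hU0']; ring
  · filter_upwards [hev] with t ht
    exact (ht.hasDerivAt hℓ hqi hhi hab hbc).differentiableAt
  · have hUφ : IsSystemSolution ℓ (fun x => q x - lam 0)
        (fun x => -((φ (lam 0, 0)).1 x * (h x - L))) U (dI ℓ U) := by
      rw [hlam0]
      exact hUs.congr_equation fun x hx => by rw [(hφE x hx).1]
    have hA := hasDerivAt_integral_sq hℓ hqi hhi hderiv hUφ hU0 hU0' hhi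
    have hB := hasDerivAt_integral_sq hℓ hqi hhi hderiv hUφ hU0 hU0'
      (g := fun _ => 1) intervalIntegrable_const
    simp only [one_mul] at hB
    rw [← hφ, hlam0] at hA hB
    have hB0 : ∫ x in (0 : ℝ)..ℓ, (φ (lam 0, 0)).1 x ^ 2 = 1 := by rw [hlam0, hnormφ]
    have hA0 : ∫ x in (0 : ℝ)..ℓ, h x * (φ (lam 0, 0)).1 x ^ 2 = L := by rw [hlam0, hLφ]
    have hquot := hA.fun_div hB (by rw [hB0]; exact one_ne_zero)
    rw [hB0, hA0] at hquot
    have heq : deriv lam =ᶠ[𝓝 0] fun s =>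
        (∫ x in (0 : ℝ)..ℓ, h x * (φ (lam s, s)).1 x ^ 2) /
          ∫ x in (0 : ℝ)..ℓ, (φ (lam s, s)).1 x ^ 2 := by
      filter_upwards [hev] with t ht
      exact (ht.hasDerivAt hℓ hqi hhi hab hbc).deriv
    refine (hquot.congr_of_eventuallyEq heq).congr_deriv ?_
    have hbdry : U ℓ * dI ℓ U ℓ = 0 := by
      have hr : U ℓ * Real.cos β - dI ℓ U ℓ * Real.sin β = 0 := hright
      rcases hβ' with rfl | rfl
      · have : U ℓ = 0 := by simpa using hr
        rw [this, zero_mul]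
      · have : dI ℓ U ℓ = 0 := by simpa using hr
        rw [this, mul_zero]
    -- The energy identity for `U` turns `2 ∫ (h - L) E U` into the stated integral, because the
    -- boundary term `U U'` vanishes at both ends.
    have hen := hUs.energy hℓ.le
    rw [hbdry, hU0, zero_mul, sub_zero] at hen
    rw [hΛ.nthEigenvalue_eq]
    have hUd := hUs.continuousOn_snd hℓ.le
    have i0 : ∀ g : ℝ → ℝ, ContinuousOn g (Icc 0 ℓ) → IntervalIntegrable g volume 0 ℓ :=
      fun g hg => ContinuousOn.intervalIntegrable (by rwa [uIcc_of_le hℓ.le])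
    have i1 : IntervalIntegrable (fun x => dI ℓ U x ^ 2 + (q x - Λ) * U x ^ 2) volume 0 ℓ :=
      (i0 _ (hUd.pow 2)).add (mul_integrable hℓ.le (hqi.sub intervalIntegrable_const) (hUc.pow 2))
    have i2 : IntervalIntegrable (fun x => h x * (2 * E x * U x)) volume 0 ℓ :=
      mul_integrable hℓ.le hhi ((continuousOn_const.mul hEc).mul hUc)
    have i3 : IntervalIntegrable (fun x => 2 * E x * U x) volume 0 ℓ :=
      i0 _ ((continuousOn_const.mul hEc).mul hUc)
    rw [hcongr (fun x => h x * (2 * (φ (Λ, 0)).1 x * U x)) (fun x => h x * (2 * E x * U x))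
        (fun x hx => by rw [(hφE x hx).1]),
      hcongr (fun x => 2 * (φ (Λ, 0)).1 x * U x) (fun x => 2 * E x * U x)
        (fun x hx => by rw [(hφE x hx).1])]
    rw [hcongr _ (fun x => (dI ℓ U x ^ 2 + (q x - Λ) * U x ^ 2) +
        (1 / 2) * (h x * (2 * E x * U x) - L * (2 * E x * U x))) (fun x _ => by ring),
      intervalIntegral.integral_add i1 ((i2.sub (i3.const_mul L)).const_mul _),
      intervalIntegral.integral_const_mul, intervalIntegral.integral_sub i2 (i3.const_mul L),
      intervalIntegral.integral_const_mul] at hen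
    linear_combination 2 * hen
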